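/- **Theorem (asymptotic distribution of the adaptive Lasso).** Fix $p$. For each $n$ let $y_n = X_n\beta_n + \varepsilon_n$, where $X_n\in\mathbb{R}^{n\times p}$ is non-random, $\beta_n\in\mathbb{R}^p$, and the components of $\varepsilon_n=(\varepsilon_{n,1},\dots,\varepsilon_{n,n})'$ are independent and identically distributed with a law that does not depend on $n$ and has mean $0$ and variance $\sigma^2\in(0,\infty)$. Assume that $X_n'X_n/n\to C$ with $C$ positive definite (so that $X_n$ has full column rank for all large $n$) and that $\max_{1\le i\le n}\sum_{j=1}^p X_{n,ij}^2/n\to0$ (this follows from $X_n'X_n/n\to C$ when $X_n$ consists of the first $n$ rows of a fixed sequence of rows). Let $\lambda_j=\lambda_{n,j}\ge0$ $(j=1,\dots,p)$ be tuning parameters, $\lambda^*=\lambda^*_n=\max_j\lambda_{n,j}$, let $\hat\beta_{\rm LS}=(X_n'X_n)^{-1}X_n'y_n$, and assume that, for all large $n$, $P(\hat\beta_{{\rm LS},j}=0)=0$ for every $j$. Let $\hat\beta_{\rm AL}$ be the minimizer over $b\in\mathbb{R}^p$ of $$L_n(b)=\|y_n-X_nb\|^2+2\sum_{j=1}^p\lambda_{n,j}\frac{|b_j|}{|\hat\beta_{{\rm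 LS},j}|}.$$ Suppose that $\lambda^*/n\to0$, $\lambda^*\to\infty$, and that for every $j$, as $n\to\infty$, $$\frac{\lambda_{n,j}}{\lambda^*}\to\lambda^0_j\in[0,1],\qquad \frac{\sqrt{\lambda^*}}{\lambda_{n,j}}\to\psi_j\in[0,\infty]\quad(\text{the ratio being }\infty\text{ if }\lambda_{n,j}=0<\lambda^*),$$ and, for every $j$ with $\psi_j<\infty$, $$\frac{\sqrt n\,\beta_{n,j}\sqrt{\lambda^*}}{\lambda_{n,j}}\to\phi_j\in\overline{\mathbb{R}};$$ for $j$ with $\psi_j=\infty$ let $\phi_j\in\overline{\mathbb{R}}$ be arbitrary (the function $V_\phi$ below does not depend on it). Let $Z\sim N(0,\sigma^2C^{-1})$ and $$V_\phi(u)=u'Cu+\sum_{j=1}^p\begin{cases}0 & u_j=0\text{ or }|\phi_j|=\infty\text{ or }\psi_j=\infty,\\ \infty & u_j\ne0\text{ and }\phi_j=\psi_j=0,\\ 2\,\dfrac{|u_j+\lambda^0_j\phi_j|-|\lambda^0_j\phi_j|}{|\phi_j+\psi_jZ_j|} & \text{else.}\end{cases}$$ Then for all large $n$ the function $L_n$ has,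 almost surely, exactly one minimizer over $\mathbb{R}^p$; almost surely $V_\phi$ has exactly one minimizer over $\mathbb{R}^p$; and $$\sqrt{\frac n{\lambda^*}}\,(\hat\beta_{\rm AL}-\beta_n)\ \overset{d}{\longrightarrow}\ \operatorname*{arg\,min}_{u\in\mathbb{R}^p}V_\phi(u).$$ -/

import Mathlib

open MeasureTheory ProbabilityTheory Filter Topology
open scoped ENNReal Matrix

namespace AdaptiveLasso

noncomputable section

open Classical in
/-- The unique minimizer of `f` over the whole space (and `0` if `f` does not have exactly one
minimizer). -/
def argmin {E F : Type*} [Zero E] [Preorder F] (f : E → F) : E :=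
  if h : ∃! m, IsMinOn f Set.univ m then h.choose else 0

/-- The ordinary least-squares estimator `(X'X)⁻¹ X'y`. -/
def lsEstimator {n p : ℕ} (X : Matrix (Fin n) (Fin p) ℝ) (y : Fin n → ℝ) :
    EuclideanSpace ℝ (Fin p) :=
  WithLp.toLp 2 ((Xᵀ * X)⁻¹ *ᵥ (Xᵀ *ᵥ y))

/-- The adaptive Lasso objective
`L(b) = ‖y - X b‖² + 2 ∑ⱼ lamⱼ |bⱼ| / |lsEstimatorⱼ|`. -/
def objective {n p : ℕ} (X : Matrix (Fin n) (Fin p) ℝ) (lam : Fin p → ℝ) (y : Fin n → ℝ)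
    (b : EuclideanSpace ℝ (Fin p)) : ℝ :=
  ∑ i, (y i - (X *ᵥ b.ofLp) i) ^ 2 + 2 * ∑ j, lam j * (|b j| / |lsEstimator X y j|)

/-- The adaptive Lasso estimator. -/
def estimator {n p : ℕ} (X : Matrix (Fin n) (Fin p) ℝ) (lam : Fin p → ℝ) (y : Fin n → ℝ) :
    EuclideanSpace ℝ (Fin p) :=
  argmin (objective X lam y)

/-- The response vector `y = X β + ε`. -/
def response {n p : ℕ} (X : Matrix (Fin n) (Fin p) ℝ) (β : EuclideanSpace ℝ (Fin p))
    (ε : Fin n → ℝ) : Fin n → ℝ :=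
  X *ᵥ β.ofLp + ε

/-- The largest tuning parameter. -/
def lamMax {p : ℕ} (lam : Fin p → ℝ) : ℝ := ⨆ j, lam j

open Classical in
/-- The contribution of one coordinate to the limiting objective: `u` is the coordinate of the
argument, `z` that of the Gaussian vector. The denominator in the last case vanishes only for
`z = - phi / psi` with `0 < psi < ∞`. -/
def limitPenalty (lam0 : ℝ) (psi : ℝ≥0∞) (phi : EReal) (z u : ℝ) : EReal :=
  if u = 0 ∨ phi = ⊤ ∨ phi = ⊥ ∨ psi = ∞ then 0
  else if phi = 0 ∧ psi = 0 then ⊤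
  else ((2 * ((|u + lam0 * phi.toReal| - |lam0 * phi.toReal|)
    / |phi.toReal + psi.toReal * z|) : ℝ) : EReal)

/-- The limiting objective `V_φ(u)` at the realization `z` of the Gaussian vector. -/
def limitObjective {p : ℕ} (C : Matrix (Fin p) (Fin p) ℝ) (lam0 : Fin p → ℝ)
    (psi : Fin p → ℝ≥0∞) (phi : Fin p → EReal) (z u : EuclideanSpace ℝ (Fin p)) : EReal :=
  ((u.ofLp ⬝ᵥ (C *ᵥ u.ofLp) : ℝ) : EReal)
    + ∑ j, limitPenalty (lam0 j) (psi j) (phi j) (z j) (u j)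

end

end AdaptiveLasso

/-!
In the coordinate `u = √(n / M) (b - β)`, with `M` the largest tuning parameter, and after division
by `M`, the adaptive Lasso objective is, up to a constant, the convex function
`(u - c)' A (u - c) + 2 ∑ⱼ wⱼ (|uⱼ + dⱼ| - |dⱼ|)` (`lassoObjective`), where `A = X'X / n`,
`dⱼ = √(n / M) βⱼ`, and `c = ζ / √M` and `wⱼ = (lamⱼ / √M) / |√n βⱼ + ζⱼ|` depend on the errors only
through the normalised least-squares error `ζ = √n (lsEstimator - β)`
(`isMinOn_lassoObjective_estimator`). So the rescaled estimator is a deterministic function `gₙ` of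
`ζ`, and three facts suffice.

* `ζ` is asymptotically normal (`tendstoInDistribution_lsEstimator`). It is a weighted sum of the
  errors with uniformly small weight vectors, and the product of the characteristic functions of the
  summands is compared with the one for Gaussian errors of the same variance: both characteristic
  functions agree to second order at the origin.
* Minimizers of `lassoObjective` depend continuously on its parameters, even if some weights tend to
  infinity while the corresponding shifts tend to zero; the limit problem is then constrained to
  `uⱼ = 0` for these `j` (`tendsto_of_isMinOn_lassoObjective`). The minimizers stay bounded because
  the quadratic part is uniformly coercive, and every cluster point is the unique minimizer of the
  limit problem. The function `V_φ` is exactly such a constrained `lassoObjective`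
  (`isMinOn_limitObjective_iff`), and the assumptions on `lam` and `β` are what makes the weights and
  shifts converge (`tendsto_minimizer_limitObjective`).
* Convergence in distribution passes through a sequence of maps `gₙ` with `gₙ (xₙ) → G (z)` whenever
  `xₙ → z`, for almost every `z` (`tendstoInDistribution_of_tendsto_prod`).

For a coordinate with `psiⱼ = ∞` no assumption controls `√n βⱼ`, while `wⱼ → 0` needs
`√n βⱼ + ζⱼ` to stay away from zero. By compactness of the extended reals `√n βⱼ` converges along a
subsequence of any given subsequence, and almost surely the Gaussian limit of `ζⱼ` is not the
negative of the limit of `√n βⱼ`. The weights of the other coordinates can only degenerate where the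
Gaussian limit hits one of finitely many points per coordinate, again a null event (`Regular`).
-/

namespace AdaptiveLasso

/-! ### A continuous mapping theorem for sequences of maps -/

/-- Continuous mapping theorem for a sequence of maps: if `Xₙ → Z` in distribution, almost surely
`Xₙ ∈ Sₙ`, and for almost every value `z` of `Z` the points `gₙ x` tend to `G z` as `n → ∞` and
`x → z` with `x ∈ Sₙ`, then `gₙ (Xₙ) → G (Z)` in distribution. The variables `gₙ (Xₙ)` are given as
`Yₙ`, so that the identity `Yₙ = gₙ (Xₙ)` may fail for finitely many `n`. -/
theorem tendstoInDistribution_of_tendsto_prod {Ω Ω' E F : Type*} [MeasurableSpace Ω]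
    [MeasurableSpace Ω'] {P : Measure Ω} [IsProbabilityMeasure P]
    {P' : Measure Ω'} [IsProbabilityMeasure P']
    [TopologicalSpace E] [MeasurableSpace E] [BorelSpace E] [HasOuterApproxClosed E]
    [TopologicalSpace F] [MeasurableSpace F] [BorelSpace F]
    {X : ℕ → Ω → E} {Z : Ω' → E}
    (hXZ : TendstoInDistribution X atTop Z (fun _ => P) P')
    {Y : ℕ → Ω → F} {g : ℕ → E → F} {G : E → F} {S : ℕ → Set E}
    (hY : ∀ n, AEMeasurable (Y n) P) (hG : AEMeasurable (fun ω => G (Z ω)) P')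
    (hYg : ∀ᶠ n in atTop, ∀ᵐ ω ∂P, X n ω ∈ S n ∧ Y n ω = g n (X n ω))
    (h : ∀ᵐ ω ∂P', Tendsto (fun q : ℕ × E => g q.1 q.2)
      ((atTop ×ˢ 𝓝 (Z ω)) ⊓ 𝓟 {q | q.2 ∈ S q.1}) (𝓝 (G (Z ω)))) :
    TendstoInDistribution Y atTop (fun ω => G (Z ω)) (fun _ => P) P' where
  forall_aemeasurable := hY
  aemeasurable_limit := hG
  tendsto := by
    -- Up to null sets, `{G (Z) ∈ O}` is covered by the increasing open sets `U N`, on each of which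
    -- `gₙ` maps into `O` for all `n ≥ N`.
    refine tendsto_of_forall_isOpen_le_liminf_nat' fun O hO => ?_
    simp only [ProbabilityMeasure.coe_mk]
    rw [Measure.map_apply_of_aemeasurable hG hO.measurableSet]
    set U : ℕ → Set E := fun N => interior {x | ∀ n ≥ N, x ∈ S n → g n x ∈ O} with hU
    have hUmono : Monotone U := fun N M hNM =>
      interior_mono fun x hx n hn => hx n (hNM.trans hn)
    have hsub : P' ((fun ω => G (Z ω)) ⁻¹' O) ≤ P' (Z ⁻¹' ⋃ N, U N) := by
      refine measure_mono_ae ?_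
      filter_upwards [h] with ω hω hGω
      have h1 := hω (hO.mem_nhds hGω)
      rw [mem_map, mem_inf_principal, mem_prod_iff] at h1
      obtain ⟨A, hA, B, hB, hAB⟩ := h1
      obtain ⟨N, hN⟩ := mem_atTop_sets.1 hA
      refine Set.mem_iUnion.2 ⟨N, mem_interior_iff_mem_nhds.2 (mem_of_superset hB ?_)⟩
      intro x hx n hn hxS
      exact hAB (Set.mk_mem_prod (hN n hn) hx) hxS
    refine hsub.trans ?_
    rw [← Measure.map_apply_of_aemeasurable hXZ.aemeasurable_limit
      (MeasurableSet.iUnion fun N => isOpen_interior.measurableSet), hUmono.measure_iUnion]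
    refine iSup_le fun N => ?_
    refine (ProbabilityMeasure.le_liminf_measure_open_of_tendsto hXZ.tendsto
      (G := U N) isOpen_interior).trans ?_
    refine liminf_le_liminf ?_
    filter_upwards [hYg, eventually_ge_atTop N] with n hn hNn
    simp only [ProbabilityMeasure.coe_mk]
    rw [Measure.map_apply_of_aemeasurable (hXZ.forall_aemeasurable n)
      isOpen_interior.measurableSet, Measure.map_apply_of_aemeasurable (hY n) hO.measurableSet]
    refine measure_mono_ae ?_
    filter_upwards [hn] with ω hω hωU
    change Y n ω ∈ O
    rw [hω.2]
    exact interior_subset hωU n hNn hω.1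

/-! ### A central limit theorem for weighted sums -/

theorem _root_.MeasureTheory.TendstoInDistribution.congr_eventually {Ω Ω' E : Type*}
    [MeasurableSpace Ω] [MeasurableSpace Ω'] {P : Measure Ω} [IsProbabilityMeasure P]
    {P' : Measure Ω'} [IsProbabilityMeasure P']
    [TopologicalSpace E] [MeasurableSpace E] [BorelSpace E]
    {X Y : ℕ → Ω → E} {Z : Ω' → E}
    (h : TendstoInDistribution X atTop Z (fun _ => P) P')
    (hY : ∀ n, AEMeasurable (Y n) P) (hXY : ∀ᶠ n in atTop, X n =ᵐ[P] Y n) :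
    TendstoInDistribution Y atTop Z (fun _ => P) P' where
  forall_aemeasurable := hY
  aemeasurable_limit := h.aemeasurable_limit
  tendsto := by
    refine h.tendsto.congr' ?_
    filter_upwards [hXY] with n hn
    exact Subtype.ext (Measure.map_congr hn)

/-- Characteristic functions of laws with equal first two moments agree to second order at `0`. -/
theorem charFun_sub_charFun_isLittleO {μ ν : Measure ℝ} [IsProbabilityMeasure μ]
    [IsProbabilityMeasure ν] (hμ : MemLp id 2 μ) (hν : MemLp id 2 ν)
    (h1 : ∫ x, x ∂μ = ∫ x, x ∂ν) (h2 : ∫ x, x ^ 2 ∂μ = ∫ x, x ^ 2 ∂ν) :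
    (fun t => charFun μ t - charFun ν t) =o[𝓝 0] fun t : ℝ => t ^ 2 := by
  have key : ∀ {ρ : Measure ℝ} [IsProbabilityMeasure ρ], MemLp id 2 ρ →
      (fun t => charFun ρ t - taylorWithinEval (charFun ρ) 2 Set.univ 0 t)
        =o[𝓝 0] fun t : ℝ => t ^ 2 := by
    intro ρ _ hρ
    refine (taylor_isLittleO_univ (x₀ := (0 : ℝ))
      (contDiff_charFun (n := 2) (by exact_mod_cast hρ))).congr_right fun t => ?_
    rw [sub_zero]
  have heq : ∀ t, taylorWithinEval (charFun μ) 2 Set.univ 0 t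
      = taylorWithinEval (charFun ν) 2 Set.univ 0 t := by
    intro t
    rw [taylorWithinEval_charFun_zero (by exact_mod_cast hμ),
      taylorWithinEval_charFun_zero (by exact_mod_cast hν)]
    simp [Finset.sum_range_succ, h1, h2]
  refine ((key hμ).sub (key hν)).congr_left fun t => ?_
  rw [heq]; ring

theorem norm_prod_sub_prod_le {ι : Type*} (s : Finset ι) (a b : ι → ℂ)
    (ha : ∀ i, ‖a i‖ ≤ 1) (hb : ∀ i, ‖b i‖ ≤ 1) :
    ‖∏ i ∈ s, a i - ∏ i ∈ s, b i‖ ≤ ∑ i ∈ s, ‖a i - b i‖ := by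
  classical
  induction s using Finset.induction_on with
  | empty => simp
  | insert i s hi ih =>
    rw [Finset.prod_insert hi, Finset.prod_insert hi, Finset.sum_insert hi]
    have h : a i * ∏ j ∈ s, a j - b i * ∏ j ∈ s, b j
        = (a i - b i) * ∏ j ∈ s, a j + b i * (∏ j ∈ s, a j - ∏ j ∈ s, b j) := by ring
    rw [h]
    refine (norm_add_le _ _).trans (add_le_add ?_ ?_)
    · rw [norm_mul]
      refine mul_le_of_le_one_right (norm_nonneg _) ?_
      rw [norm_prod]
      exact Finset.prod_le_one (fun _ _ => norm_nonneg _) fun j _ => ha j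
    · rw [norm_mul]
      exact (mul_le_of_le_one_left (norm_nonneg _) (hb i)).trans ih

/-- Lindeberg-type limit of characteristic functions: for a centred law `ν` of variance `σ ^ 2` and
a uniformly small array `a` whose sums of squares converge to `s`, the characteristic functions at
`1` of the sums `∑ᵢ aₙᵢ εᵢ` with independent `εᵢ ∼ ν` converge to that of `N(0, σ ^ 2 s)`. -/
theorem tendsto_prod_charFun {ν : Measure ℝ} [IsProbabilityMeasure ν] {σ : ℝ}
    (hν2 : MemLp id 2 ν) (hν_mean : ∫ x, x ∂ν = 0) (hν_var : ∫ x, x ^ 2 ∂ν = σ ^ 2)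
    {a : (n : ℕ) → Fin n → ℝ} {s : ℝ} (hs : Tendsto (fun n => ∑ i, a n i ^ 2) atTop (𝓝 s))
    (ha : ∀ δ : ℝ, 0 < δ → ∀ᶠ n in atTop, ∀ i, |a n i| ≤ δ) :
    Tendsto (fun n => ∏ i, charFun ν (a n i)) atTop (𝓝 (Complex.exp (-(σ ^ 2 * s / 2 : ℝ)))) := by
  -- For the Gaussian law with the moments of `ν` the limit is explicit.
  set γ : Measure ℝ := gaussianReal 0 (σ ^ 2).toNNReal with hγ
  have hγ2 : MemLp id 2 γ := memLp_id_gaussianReal 2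
  have hγ_mean : ∫ x, x ∂γ = 0 := integral_id_gaussianReal
  have hγ_var : ∫ x, x ^ 2 ∂γ = σ ^ 2 := by
    have h := variance_of_integral_eq_zero (μ := γ) (X := id) aemeasurable_id
      (by simpa using hγ_mean)
    simpa [hγ, Real.coe_toNNReal _ (sq_nonneg σ)] using h.symm
  have hgauss : Tendsto (fun n => ∏ i, charFun γ (a n i)) atTop
      (𝓝 (Complex.exp (-(σ ^ 2 * s / 2 : ℝ)))) := by
    have : ∀ n, ∏ i, charFun γ (a n i)
        = Complex.exp (-(σ ^ 2 * (∑ i, a n i ^ 2) / 2 : ℝ)) := by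
      intro n
      simp only [hγ, charFun_gaussianReal, ← Complex.exp_sum]
      congr 1
      push_cast
      rw [Finset.mul_sum, Finset.sum_div, ← Finset.sum_neg_distrib]
      refine Finset.sum_congr rfl fun i _ => ?_
      simp [Real.coe_toNNReal _ (sq_nonneg σ)]
    simp only [this]
    have hc : Continuous fun x : ℝ => Complex.exp (-(σ ^ 2 * x / 2 : ℝ)) := by fun_prop
    exact (hc.tendsto s).comp hs
  have hdiff : Tendsto (fun n => ∏ i, charFun ν (a n i) - ∏ i, charFun γ (a n i)) atTop (𝓝 0) := by
    rw [Metric.tendsto_atTop']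
    intro η hη
    have hlo := charFun_sub_charFun_isLittleO hν2 hγ2 (hν_mean.trans hγ_mean.symm)
      (hν_var.trans hγ_var.symm)
    have hs1 : 0 < |s| + 1 := by positivity
    have hη' : 0 < η / (2 * (|s| + 1)) := by positivity
    have hb := hlo.bound hη'
    obtain ⟨δ, hδ, hball⟩ := Metric.eventually_nhds_iff.1 hb
    have hev : ∀ᶠ n in atTop, ∑ i, a n i ^ 2 < |s| + 1 :=
      hs.eventually_lt_const (by linarith [le_abs_self s])
    have hfin : ∀ᶠ n in atTop,
        dist (∏ i, charFun ν (a n i) - ∏ i, charFun γ (a n i)) 0 < η := by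
      filter_upwards [hev, ha (δ / 2) (by positivity)] with n hn1 hn2
      rw [dist_zero_right]
      calc _ ≤ ∑ i, ‖charFun ν (a n i) - charFun γ (a n i)‖ :=
            norm_prod_sub_prod_le _ _ _ (fun _ => norm_charFun_le_one _)
              fun _ => norm_charFun_le_one _
        _ ≤ ∑ i, η / (2 * (|s| + 1)) * a n i ^ 2 := by
            refine Finset.sum_le_sum fun i _ => ?_
            have := hball (y := a n i) (by rw [dist_zero_right, Real.norm_eq_abs]; linarith [hn2 i])
            simpa using this
        _ = η / (2 * (|s| + 1)) * ∑ i, a n i ^ 2 := by rw [Finset.mul_sum]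
        _ ≤ η / (2 * (|s| + 1)) * (|s| + 1) := by gcongr
        _ = η / 2 := by field_simp
        _ < η := by linarith
    obtain ⟨N, hN⟩ := eventually_atTop.1 hfin
    exact ⟨N, fun n hn => hN n hn.le⟩
  simpa using hdiff.add hgauss

/-- Multivariate central limit theorem for weighted sums of independent identically distributed
errors with uniformly small deterministic weight vectors. -/
theorem tendstoInDistribution_sum_smul {Ω Ω' : Type*} [MeasurableSpace Ω]
    [MeasurableSpace Ω'] {P : Measure Ω} [IsProbabilityMeasure P]
    {P' : Measure Ω'} [IsProbabilityMeasure P'] {ι : Type*} [Fintype ι] [DecidableEq ι]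
    {ν : Measure ℝ} {σ : ℝ}
    (hν2 : MemLp id 2 ν) (hν_mean : ∫ x, x ∂ν = 0) (hν_var : ∫ x, x ^ 2 ∂ν = σ ^ 2)
    {ε : (n : ℕ) → Fin n → Ω → ℝ}
    (hε_law : ∀ n i, HasLaw (ε n i) ν P) (hε_indep : ∀ n, iIndepFun (ε n) P)
    {v : (n : ℕ) → Fin n → EuclideanSpace ℝ ι} {S : Matrix ι ι ℝ} (hS : S.PosSemidef)
    (hv : ∀ δ : ℝ, 0 < δ → ∀ᶠ n in atTop, ∀ i, ‖v n i‖ ≤ δ)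
    (hvS : ∀ t : EuclideanSpace ℝ ι, Tendsto (fun n => ∑ i, inner ℝ (v n i) t ^ 2) atTop
      (𝓝 (t.ofLp ⬝ᵥ S *ᵥ t.ofLp)))
    {Z : Ω' → EuclideanSpace ℝ ι} (hZ : HasLaw Z (multivariateGaussian 0 (σ ^ 2 • S)) P') :
    TendstoInDistribution (fun n ω => ∑ i, ε n i ω • v n i) atTop Z (fun _ => P) P' where
  forall_aemeasurable n := Finset.aemeasurable_fun_sum _ fun i _ =>
    (hε_law n i).aemeasurable.smul_const _
  aemeasurable_limit := hZ.aemeasurable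
  tendsto := by
    have hνP : IsProbabilityMeasure ν := (hε_law 1 0).isProbabilityMeasure_iff.1 inferInstance
    refine ProbabilityMeasure.tendsto_iff_tendsto_charFun.2 fun t => ?_
    simp only [ProbabilityMeasure.coe_mk]
    have hlim : charFun (P'.map Z) t
        = Complex.exp (-(σ ^ 2 * (t.ofLp ⬝ᵥ S *ᵥ t.ofLp) / 2 : ℝ)) := by
      rw [hZ.map_eq, charFun_multivariateGaussian (hS.smul (sq_nonneg σ))]
      simp [Matrix.smul_mulVec]
    have hfun : ∀ n, charFun (P.map fun ω => ∑ i, ε n i ω • v n i) t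
        = ∏ i, charFun ν (inner ℝ (v n i) t) := by
      intro n
      have hm : ∀ i, AEMeasurable (fun ω => ε n i ω • v n i) P := fun i =>
        (hε_law n i).aemeasurable.smul_const _
      have hind : iIndepFun (fun i ω => ε n i ω • v n i) P :=
        (hε_indep n).comp (fun i x => x • v n i) fun i => by fun_prop
      rw [hind.charFun_map_fun_sum_eq_prod hm, Finset.prod_apply]
      refine Finset.prod_congr rfl fun i _ => ?_
      rw [charFun_apply, charFun_apply, integral_map (hm i) (by fun_prop),
        ← (hε_law n i).map_eq, integral_map (hε_law n i).aemeasurable (by fun_prop)]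
      simp [inner_smul_left, mul_comm]
    rw [hlim]
    simp only [hfun]
    refine tendsto_prod_charFun hν2 hν_mean hν_var (hvS t) fun δ hδ => ?_
    filter_upwards [hv (δ / (‖t‖ + 1)) (by positivity)] with n hn i
    calc |inner ℝ (v n i) t| ≤ ‖v n i‖ * ‖t‖ := abs_real_inner_le_norm _ _
      _ ≤ δ / (‖t‖ + 1) * (‖t‖ + 1) := by gcongr; exacts [hn i, by linarith]
      _ = δ := by field_simp

/-! ### Penalised quadratic functions and the stability of their minimizers -/

section

variable {ι κ : Type*} [Fintype ι]

/-- The quadratic form of `A` centred at `c` plus a weighted `ℓ¹` penalty with weights `w` and kinks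
at `-d`. Subtracting `|d j|` changes it by a constant only, and keeps it bounded when `d j` is
unbounded while `w j` tends to `0`. -/
def lassoObjective (A : Matrix ι ι ℝ) (c : EuclideanSpace ℝ ι) (w d : ι → ℝ)
    (u : EuclideanSpace ℝ ι) : ℝ :=
  (u - c).ofLp ⬝ᵥ A *ᵥ (u - c).ofLp + 2 * ∑ j, w j * (|u j + d j| - |d j|)

theorem continuous_quadratic :
    Continuous fun q : Matrix ι ι ℝ × EuclideanSpace ℝ ι => q.2.ofLp ⬝ᵥ q.1 *ᵥ q.2.ofLp := by
  simp only [dotProduct, Matrix.mulVec]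
  refine continuous_finsetSum _ fun i _ => Continuous.mul (by fun_prop) ?_
  refine continuous_finsetSum _ fun j _ => Continuous.mul ?_ (by fun_prop)
  exact (continuous_apply_apply i j).comp continuous_fst

theorem tendsto_quadratic {l : Filter κ} {A : κ → Matrix ι ι ℝ} {C : Matrix ι ι ℝ}
    (hA : Tendsto A l (𝓝 C)) {u : κ → EuclideanSpace ℝ ι} {v : EuclideanSpace ℝ ι}
    (hu : Tendsto u l (𝓝 v)) :
    Tendsto (fun k => (u k).ofLp ⬝ᵥ A k *ᵥ (u k).ofLp) l (𝓝 (v.ofLp ⬝ᵥ C *ᵥ v.ofLp)) :=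
  (continuous_quadratic.tendsto (C, v)).comp (hA.prodMk_nhds hu)

theorem exists_le_quadratic {C : Matrix ι ι ℝ} (hC : C.PosDef) :
    ∃ a : ℝ, 0 < a ∧ ∀ v : EuclideanSpace ℝ ι, a * ‖v‖ ^ 2 ≤ v.ofLp ⬝ᵥ C *ᵥ v.ofLp := by
  have hpos : ∀ v : EuclideanSpace ℝ ι, v ≠ 0 → 0 < v.ofLp ⬝ᵥ C *ᵥ v.ofLp := fun v hv => by
    have := hC.dotProduct_mulVec_pos (x := v.ofLp) (by simpa using hv)
    simpa using this
  have hcont : Continuous fun v : EuclideanSpace ℝ ι => v.ofLp ⬝ᵥ C *ᵥ v.ofLp :=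
    continuous_quadratic.comp (Continuous.prodMk_right C)
  rcases (Metric.sphere (0 : EuclideanSpace ℝ ι) 1).eq_empty_or_nonempty with h | h
  · refine ⟨1, one_pos, fun v => ?_⟩
    by_cases hv : v = 0
    · simp [hv]
    · have : (‖v‖⁻¹ • v) ∈ Metric.sphere (0 : EuclideanSpace ℝ ι) 1 := by
        simp [norm_smul, hv]
      simp [h] at this
  · obtain ⟨v0, hv0, hmin⟩ := (isCompact_sphere (0 : EuclideanSpace ℝ ι) 1).exists_isMinOn h
      hcont.continuousOn
    refine ⟨_, hpos v0 (by rintro rfl; simp at hv0), fun v => ?_⟩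
    by_cases hv : v = 0
    · simp [hv]
    have hvn : ‖v‖ ≠ 0 := norm_ne_zero_iff.2 hv
    have hmem : (‖v‖⁻¹ • v) ∈ Metric.sphere (0 : EuclideanSpace ℝ ι) 1 := by
      simp [norm_smul, hv]
    have h1 : v0.ofLp ⬝ᵥ C *ᵥ v0.ofLp ≤ _ := hmin hmem
    simp only [WithLp.ofLp_smul, Matrix.mulVec_smul, dotProduct_smul, smul_dotProduct,
      smul_eq_mul] at h1
    calc _ ≤ (‖v‖⁻¹ * (‖v‖⁻¹ * (v.ofLp ⬝ᵥ C *ᵥ v.ofLp))) * ‖v‖ ^ 2 := by gcongr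
      _ = _ := by field_simp

theorem abs_quadratic_le (A : Matrix ι ι ℝ) (v : EuclideanSpace ℝ ι) :
    |v.ofLp ⬝ᵥ A *ᵥ v.ofLp| ≤ (∑ i, ∑ j, |A i j|) * ‖v‖ ^ 2 := by
  simp only [dotProduct, Matrix.mulVec, Finset.mul_sum, Finset.sum_mul]
  refine (Finset.abs_sum_le_sum_abs _ _).trans (Finset.sum_le_sum fun i _ => ?_)
  refine (Finset.abs_sum_le_sum_abs _ _).trans (Finset.sum_le_sum fun j _ => ?_)
  have hi : |v i| ≤ ‖v‖ := PiLp.norm_apply_le v i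
  have hj : |v j| ≤ ‖v‖ := PiLp.norm_apply_le v j
  rw [abs_mul, abs_mul]
  calc |v i| * (|A i j| * |v j|) = |A i j| * (|v i| * |v j|) := by ring
    _ ≤ |A i j| * (‖v‖ * ‖v‖) := by gcongr
    _ = _ := by ring

theorem eventually_le_quadratic {l : Filter κ} {A : κ → Matrix ι ι ℝ} {C : Matrix ι ι ℝ}
    (hC : C.PosDef) (hA : Tendsto A l (𝓝 C)) :
    ∃ a : ℝ, 0 < a ∧ ∀ᶠ k in l, ∀ v : EuclideanSpace ℝ ι,
      a * ‖v‖ ^ 2 ≤ v.ofLp ⬝ᵥ A k *ᵥ v.ofLp := by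
  obtain ⟨a, ha, hav⟩ := exists_le_quadratic hC
  refine ⟨a / 2, by positivity, ?_⟩
  have hsum : Tendsto (fun k => ∑ i, ∑ j, |(A k - C) i j|) l (𝓝 0) := by
    have h0 : (0 : ℝ) = ∑ i : ι, ∑ j : ι, |(C - C) i j| := by simp
    rw [h0]
    refine tendsto_finsetSum _ fun i _ => tendsto_finsetSum _ fun j _ => ?_
    have := ((continuous_apply_apply i j).tendsto _).comp (hA.sub (tendsto_const_nhds (x := C)))
    exact this.abs
  filter_upwards [hsum.eventually_le_const (show (0 : ℝ) < a / 2 by positivity)] with k hk v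
  have h1 := abs_quadratic_le (A k - C) v
  rw [Matrix.sub_mulVec, dotProduct_sub] at h1
  have h2 := (abs_le.1 h1).1
  have h3 := hav v
  have h4 : (∑ i, ∑ j, |(A k - C) i j|) * ‖v‖ ^ 2 ≤ a / 2 * ‖v‖ ^ 2 := by gcongr
  linarith

theorem continuous_lassoObjective (A : Matrix ι ι ℝ) (c : EuclideanSpace ℝ ι) (w d : ι → ℝ) :
    Continuous (lassoObjective A c w d) := by
  unfold lassoObjective
  refine Continuous.add ?_ (by fun_prop)
  exact continuous_quadratic.comp (Continuous.prodMk continuous_const (by fun_prop))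

/-- A minimizer exists on the subspace where the coordinates in `T` vanish, by coercivity. -/
theorem exists_isMinOn_lassoObjective {A : Matrix ι ι ℝ} (hA : A.PosDef)
    (c : EuclideanSpace ℝ ι) {w : ι → ℝ} (hw : ∀ j, 0 ≤ w j) (d : ι → ℝ) (T : Set ι) :
    ∃ m ∈ {u : EuclideanSpace ℝ ι | ∀ j ∈ T, u j = 0},
      IsMinOn (lassoObjective A c w d) {u | ∀ j ∈ T, u j = 0} m := by
  obtain ⟨a, ha, hav⟩ := exists_le_quadratic hA
  have hcl : IsClosed {u : EuclideanSpace ℝ ι | ∀ j ∈ T, u j = 0} := by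
    simp only [Set.ofPred_forall]
    exact isClosed_iInter fun j => isClosed_iInter fun _ =>
      isClosed_eq (by fun_prop) continuous_const
  refine (continuous_lassoObjective A c w d).continuousOn.exists_isMinOn' hcl (x₀ := 0)
    (by simp) (Eventually.filter_mono inf_le_left ?_)
  have hlim : Tendsto (fun u : EuclideanSpace ℝ ι => a * ‖u - c‖ ^ 2 + 2 * ∑ j, w j * (-|d j|))
      (cocompact _) atTop := by
    refine tendsto_atTop_add_const_right _ _ (Tendsto.const_mul_atTop ha ?_)
    refine (tendsto_pow_atTop two_ne_zero).comp ?_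
    have : Tendsto (fun u : EuclideanSpace ℝ ι => ‖u‖ + -‖c‖) (cocompact _) atTop :=
      tendsto_atTop_add_const_right _ _ tendsto_norm_cocompact_atTop
    exact tendsto_atTop_mono (fun u => by linarith [norm_sub_norm_le u c]) this
  filter_upwards [hlim.eventually_ge_atTop (lassoObjective A c w d 0)] with u hu
  refine hu.trans ?_
  unfold lassoObjective
  gcongr with j
  · exact hav _
  · exact hw j
  · linarith [abs_nonneg (u j + d j)]

/-- Strict midpoint convexity: the parallelogram identity for the quadratic part, the triangle
inequality for the penalty. -/
theorem lassoObjective_midpoint_lt {A : Matrix ι ι ℝ} (hA : A.PosDef)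
    (c : EuclideanSpace ℝ ι) {w : ι → ℝ} (hw : ∀ j, 0 ≤ w j) (d : ι → ℝ)
    {x y : EuclideanSpace ℝ ι} (hxy : x ≠ y) :
    2 * lassoObjective A c w d ((1 / 2 : ℝ) • (x + y))
      < lassoObjective A c w d x + lassoObjective A c w d y := by
  have hpos := hA.dotProduct_mulVec_pos (x := (x - y).ofLp)
    (fun h => hxy (sub_eq_zero.1 (WithLp.ofLp_injective 2 h)))
  have hpar : ∀ s t : ι → ℝ, 2 * (((1 / 2 : ℝ) • (s + t)) ⬝ᵥ A *ᵥ ((1 / 2 : ℝ) • (s + t)))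
      + (1 / 2) * ((s - t) ⬝ᵥ A *ᵥ (s - t)) = s ⬝ᵥ A *ᵥ s + t ⬝ᵥ A *ᵥ t := by
    intro s t
    simp only [Matrix.mulVec_smul, dotProduct_smul, smul_dotProduct, Matrix.mulVec_add,
      Matrix.mulVec_sub, dotProduct_add, dotProduct_sub, add_dotProduct, sub_dotProduct,
      smul_eq_mul]
    ring
  have h1 := hpar (x - c).ofLp (y - c).ofLp
  have e1 : ((1 / 2 : ℝ) • (x + y) - c).ofLp = (1 / 2 : ℝ) • ((x - c).ofLp + (y - c).ofLp) := by
    ext j; simp; ring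
  have e2 : (x - c).ofLp - (y - c).ofLp = (x - y).ofLp := by
    ext j; simp
  rw [← e1, e2] at h1
  have hpen : 2 * ∑ j, w j * (|((1 / 2 : ℝ) • (x + y)) j + d j| - |d j|)
      ≤ ∑ j, w j * (|x j + d j| - |d j|) + ∑ j, w j * (|y j + d j| - |d j|) := by
    rw [Finset.mul_sum, ← Finset.sum_add_distrib]
    refine Finset.sum_le_sum fun j _ => ?_
    have h3 : 2 * |((1 / 2 : ℝ) • (x + y)) j + d j| ≤ |x j + d j| + |y j + d j| := by
      refine le_trans (le_of_eq ?_) (abs_add_le _ _)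
      rw [← abs_two (α := ℝ), ← abs_mul]
      congr 1
      simp; ring
    nlinarith [hw j]
  simp only [star_trivial] at hpos
  unfold lassoObjective
  linarith

theorem eq_of_isMinOn_lassoObjective {A : Matrix ι ι ℝ} (hA : A.PosDef)
    {c : EuclideanSpace ℝ ι} {w : ι → ℝ} (hw : ∀ j, 0 ≤ w j) {d : ι → ℝ} {T : Set ι}
    {x y : EuclideanSpace ℝ ι} (hxT : ∀ j ∈ T, x j = 0) (hyT : ∀ j ∈ T, y j = 0)
    (hx : IsMinOn (lassoObjective A c w d) {u | ∀ j ∈ T, u j = 0} x)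
    (hy : IsMinOn (lassoObjective A c w d) {u | ∀ j ∈ T, u j = 0} y) : x = y := by
  by_contra hxy
  have h := lassoObjective_midpoint_lt hA c hw d hxy
  have hmem : (1 / 2 : ℝ) • (x + y) ∈ {u : EuclideanSpace ℝ ι | ∀ j ∈ T, u j = 0} :=
    fun j hj => by simp [hxT j hj, hyT j hj]
  have h1 : lassoObjective A c w d x ≤ _ := hx hmem
  have h2 : lassoObjective A c w d y ≤ _ := hy hmem
  linarith

/-- If the weight tends to `0`, nothing is needed of the shift `d`. -/
theorem tendsto_weighted_abs {l : Filter κ} {w d u : κ → ℝ} {w0 d0 u0 : ℝ}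
    (hw : Tendsto w l (𝓝 w0)) (hd : w0 = 0 ∨ Tendsto d l (𝓝 d0)) (hu : Tendsto u l (𝓝 u0)) :
    Tendsto (fun k => w k * (|u k + d k| - |d k|)) l (𝓝 (w0 * (|u0 + d0| - |d0|))) := by
  rcases hd with rfl | hd
  · rw [zero_mul]
    have h : Tendsto (fun k => |w k| * |u k|) l (𝓝 0) := by
      simpa using hw.abs.mul hu.abs
    refine squeeze_zero_norm (fun k => ?_) h
    rw [Real.norm_eq_abs, abs_mul]
    refine mul_le_mul_of_nonneg_left ?_ (abs_nonneg _)
    refine (abs_abs_sub_abs_le_abs_sub (u k + d k) (d k)).trans_eq ?_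
    rw [add_sub_cancel_right]
  · exact hw.mul ((hu.add hd).abs.sub hd.abs)

/-- Stability of minimizers. On `T` the weights diverge and the shifts vanish, which in the limit
forces these coordinates to be `0`; off `T` the weights converge, and so do the shifts unless the
limiting weight is `0`. -/
theorem tendsto_of_isMinOn_lassoObjective {l : Filter κ}
    {A : κ → Matrix ι ι ℝ} {C : Matrix ι ι ℝ} (hC : C.PosDef) (hA : Tendsto A l (𝓝 C))
    {c : κ → EuclideanSpace ℝ ι} {c0 : EuclideanSpace ℝ ι} (hc : Tendsto c l (𝓝 c0))
    {w d : κ → ι → ℝ} (hw : ∀ k j, 0 ≤ w k j)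
    {w0 d0 : ι → ℝ} (hw0 : ∀ j, 0 ≤ w0 j) {T : Set ι} (hw0T : ∀ j ∈ T, w0 j = 0)
    (hwT : ∀ j ∈ T, Tendsto (fun k => w k j) l atTop)
    (hdT : ∀ j ∈ T, Tendsto (fun k => d k j) l (𝓝 0))
    (hwF : ∀ j ∉ T, Tendsto (fun k => w k j) l (𝓝 (w0 j)))
    (hdF : ∀ j ∉ T, w0 j = 0 ∨ Tendsto (fun k => d k j) l (𝓝 (d0 j)))
    {m : κ → EuclideanSpace ℝ ι} {m0 : EuclideanSpace ℝ ι}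
    (hm : ∀ᶠ k in l, IsMinOn (lassoObjective (A k) (c k) (w k) (d k)) Set.univ (m k))
    (hm0T : ∀ j ∈ T, m0 j = 0)
    (hm0 : IsMinOn (lassoObjective C c0 w0 d0) {u | ∀ j ∈ T, u j = 0} m0) :
    Tendsto m l (𝓝 m0) := by
  classical
  -- Up to the constant `2 ∑_{j ∈ T} w k j * |d k j|`, which may diverge, the objective is `H k + R k`
  -- with `R k ≥ 0` the penalty on the coordinates in `T`.
  set H : κ → EuclideanSpace ℝ ι → ℝ := fun k u => (u - c k).ofLp ⬝ᵥ A k *ᵥ (u - c k).ofLp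
    + 2 * ∑ j, (if j ∈ T then 0 else w k j * (|u j + d k j| - |d k j|)) with hHdef
  set R : κ → EuclideanSpace ℝ ι → ℝ := fun k u =>
    2 * ∑ j, (if j ∈ T then w k j * |u j + d k j| else 0) with hRdef
  have hsplit : ∀ k u, lassoObjective (A k) (c k) (w k) (d k) u
      = H k u + R k u - 2 * ∑ j, (if j ∈ T then w k j * |d k j| else 0) := by
    intro k u
    simp only [lassoObjective, hHdef, hRdef]
    rw [add_assoc, add_sub_assoc, ← mul_add, ← mul_sub, ← Finset.sum_add_distrib,
      ← Finset.sum_sub_distrib]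
    congr 2
    refine Finset.sum_congr rfl fun j _ => ?_
    split_ifs <;> ring
  have hRnn : ∀ k u, 0 ≤ R k u := fun k u => by
    refine mul_nonneg zero_le_two (Finset.sum_nonneg fun j _ => ?_)
    split_ifs
    exacts [mul_nonneg (hw k j) (abs_nonneg _), le_rfl]
  have hHlim : ∀ {l' : Filter κ}, l' ≤ l → ∀ {u : κ → EuclideanSpace ℝ ι} {v},
      Tendsto u l' (𝓝 v) → Tendsto (fun k => H k (u k)) l' (𝓝 (lassoObjective C c0 w0 d0 v)) := by
    intro l' hl u v hu
    refine (tendsto_quadratic (hA.mono_left hl) (hu.sub (hc.mono_left hl))).add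
      (Tendsto.const_mul _ (tendsto_finsetSum _ fun j _ => ?_))
    by_cases hj : j ∈ T
    · simpa [hj, hw0T j hj] using tendsto_const_nhds
    · simp only [hj, if_false]
      exact tendsto_weighted_abs ((hwF j hj).mono_left hl)
        ((hdF j hj).imp_right fun h => h.mono_left hl)
        (((PiLp.continuous_apply 2 _ j).tendsto v).comp hu)
  -- The competitor `t k` has `R k (t k) = 0`; `m0` itself need not, as `d k j` may be nonzero.
  set t : κ → EuclideanSpace ℝ ι := fun k =>
    WithLp.toLp 2 fun j => if j ∈ T then -d k j else m0 j with htdef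
  have ht : Tendsto t l (𝓝 m0) := by
    have h1 : Tendsto (fun k j => if j ∈ T then -d k j else m0 j) l (𝓝 m0.ofLp) := by
      refine tendsto_pi_nhds.2 fun j => ?_
      by_cases hj : j ∈ T
      · simpa [hj, hm0T j hj] using (hdT j hj).neg
      · simpa [hj] using tendsto_const_nhds
    exact ((PiLp.continuous_toLp 2 _).tendsto _).comp h1
  have hRt : ∀ k, R k (t k) = 0 := by
    intro k
    simp only [hRdef, htdef]
    rw [Finset.sum_eq_zero, mul_zero]
    intro j _
    by_cases hj : j ∈ T <;> simp [hj]
  have hle : ∀ᶠ k in l, H k (m k) + R k (m k) ≤ H k (t k) := by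
    filter_upwards [hm] with k hk
    have h1 : lassoObjective (A k) (c k) (w k) (d k) (m k) ≤ _ := hk (Set.mem_univ (t k))
    rw [hsplit, hsplit, hRt] at h1
    linarith
  -- The minimizers stay bounded: `H k` grows quadratically, uniformly in `k`.
  obtain ⟨a, ha, hquad⟩ := eventually_le_quadratic hC hA
  set W : ℝ := 2 * ∑ j, (w0 j + 1) with hWdef
  have hW : 0 ≤ W := mul_nonneg zero_le_two (Finset.sum_nonneg fun j _ => by linarith [hw0 j])
  set K : ℝ := |lassoObjective C c0 w0 d0 m0| + 1 with hKdef
  have hK : 0 ≤ K := by positivity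
  set c1 : ℝ := ‖c0‖ + 1 with hc1def
  have hbdd : ∀ᶠ k in l, ‖m k‖ ≤ (1 + (K + W * c1 + W) / a) + c1 := by
    have e1 : ∀ᶠ k in l, H k (t k) ≤ K := (hHlim le_rfl ht).eventually_le_const
      (by linarith [le_abs_self (lassoObjective C c0 w0 d0 m0)])
    have e2 : ∀ᶠ k in l, ‖c k‖ ≤ c1 := hc.norm.eventually_le_const (by linarith)
    have e3 : ∀ᶠ k in l, ∀ j, j ∉ T → w k j ≤ w0 j + 1 := by
      rw [eventually_all]
      intro j
      by_cases hj : j ∈ T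
      · simp [hj]
      · filter_upwards [(hwF j hj).eventually_le_const (lt_add_one _)] with k hk _ using hk
    filter_upwards [e1, e2, e3, hle, hquad] with k h1 h2 h3 h4 h5
    have h6 : a * ‖m k - c k‖ ^ 2 - W * ‖m k‖ ≤ H k (m k) := by
      have h7 : -(W * ‖m k‖) ≤ 2 * ∑ j, (if j ∈ T then 0 else
          w k j * (|m k j + d k j| - |d k j|)) := by
        rw [hWdef, mul_assoc, ← mul_neg, Finset.sum_mul, ← Finset.sum_neg_distrib]
        gcongr with j
        split_ifs with hj
        · have := mul_nonneg (add_nonneg (hw0 j) zero_le_one) (norm_nonneg (m k))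
          linarith
        · have h8 : |d k j| - |m k j + d k j| ≤ ‖m k‖ := by
            have h9 := abs_sub_abs_le_abs_sub (d k j) (m k j + d k j)
            have h10 : |d k j - (m k j + d k j)| = |m k j| := by
              rw [← abs_neg]; congr 1; ring
            have h11 : |m k j| ≤ ‖m k‖ := PiLp.norm_apply_le (m k) j
            linarith
          have h12 := mul_le_mul_of_nonneg_left h8 (hw k j)
          have h13 := mul_le_mul_of_nonneg_right (h3 j hj) (norm_nonneg (m k))
          linarith
      have := h5 (m k - c k)
      simp only [hHdef]
      linarith
    have h14 := hRnn k (m k)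
    have h15 : ‖m k‖ ≤ ‖m k - c k‖ + c1 := by
      have := norm_le_norm_sub_add (m k) (c k)
      linarith
    set x := ‖m k - c k‖ with hx
    have hx0 : 0 ≤ x := norm_nonneg _
    have h16 : a * x ^ 2 ≤ K + W * (x + c1) := by
      have := mul_le_mul_of_nonneg_left h15 hW
      linarith
    have h17 : x ≤ 1 + (K + W * c1 + W) / a := by
      have hc1 : 0 ≤ c1 := by positivity
      have hnn : 0 ≤ (K + W * c1 + W) / a := by positivity
      by_contra! hcon
      have h1x : 1 ≤ x := by linarith
      have h18 : (K + W * c1 + W) / a < x := by linarith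
      rw [div_lt_iff₀ ha] at h18
      have h19 : 0 ≤ K + W * c1 := by positivity
      nlinarith [mul_lt_mul_of_pos_right h18 (by linarith : 0 < x),
        mul_le_mul_of_nonneg_left h1x h19]
    linarith
  -- By compactness it remains to identify the limit `m'` of `m` along an arbitrary ultrafilter.
  rw [tendsto_iff_ultrafilter]
  intro U hU
  obtain ⟨m', -, hm'⟩ := (isCompact_closedBall (0 : EuclideanSpace ℝ ι)
    ((1 + (K + W * c1 + W) / a) + c1)).ultrafilter_le_nhds (U.map m) (by
      rw [le_principal_iff]
      exact (hbdd.filter_mono hU).mono fun k hk => by simpa using hk)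
  have hmU : Tendsto m U (𝓝 m') := hm'
  have hHm := hHlim hU hmU
  have hHt := hHlim hU (ht.mono_left hU)
  have hle' := hle.filter_mono hU
  have hm'T : ∀ j ∈ T, m' j = 0 := by
    intro j hj
    -- `R k (m k)` is bounded by a convergent quantity, and the weight in it diverges.
    have h1 : Tendsto (fun k => (H k (t k) - H k (m k)) / (2 * w k j)) U (𝓝 0) :=
      (hHt.sub hHm).div_atTop (Tendsto.const_mul_atTop two_pos ((hwT j hj).mono_left hU))
    have h2 : Tendsto (fun k => m k j + d k j) U (𝓝 0) := by
      refine squeeze_zero_norm' ?_ h1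
      filter_upwards [hle', ((hwT j hj).mono_left hU).eventually_gt_atTop 0] with k hk hwk
      rw [Real.norm_eq_abs, le_div_iff₀ (by positivity)]
      have h3 : w k j * |m k j + d k j| ≤
          ∑ i, (if i ∈ T then w k i * |m k i + d k i| else 0) := by
        have := Finset.single_le_sum
          (f := fun i => if i ∈ T then w k i * |m k i + d k i| else 0) (fun i _ => by
            dsimp only
            split_ifs
            exacts [mul_nonneg (hw k i) (abs_nonneg _), le_rfl]) (Finset.mem_univ j)
        simpa [hj] using this
      simp only [hRdef] at hk
      linarith
    have h4 : Tendsto (fun k => m k j + d k j) U (𝓝 (m' j + 0)) :=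
      (((PiLp.continuous_apply 2 _ j).tendsto m').comp hmU).add ((hdT j hj).mono_left hU)
    simpa using tendsto_nhds_unique h4 h2
  have hV : lassoObjective C c0 w0 d0 m' ≤ lassoObjective C c0 w0 d0 m0 :=
    le_of_tendsto_of_tendsto hHm hHt (hle'.mono fun k hk => by linarith [hRnn k (m k)])
  have : m' = m0 := eq_of_isMinOn_lassoObjective hC hw0 hm'T hm0T
    (fun u hu => hV.trans (hm0 hu)) hm0
  exact this ▸ hmU

end

section

theorem isMinOn_argmin {E F : Type*} [Zero E] [Preorder F] {f : E → F}
    (h : ∃! m, IsMinOn f Set.univ m) : IsMinOn f Set.univ (argmin f) := by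
  rw [argmin, dif_pos h]
  exact h.choose_spec.1

theorem existsUnique_isMinOn_lassoObjective {ι : Type*} [Fintype ι] {A : Matrix ι ι ℝ}
    (hA : A.PosDef) (c : EuclideanSpace ℝ ι) {w : ι → ℝ} (hw : ∀ j, 0 ≤ w j) (d : ι → ℝ) :
    ∃! m, IsMinOn (lassoObjective A c w d) Set.univ m := by
  obtain ⟨m, -, hm⟩ := exists_isMinOn_lassoObjective hA c hw d ∅
  refine ⟨m, by simpa using hm, fun m' hm' => ?_⟩
  exact eq_of_isMinOn_lassoObjective (T := ∅) hA hw (by simp) (by simp) (by simpa using hm') hm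

/-! ### The estimator as a minimizer of the penalised quadratic -/

variable {n p : ℕ}

theorem posDef_of_isUnit {X : Matrix (Fin n) (Fin p) ℝ} (hX : IsUnit (Xᵀ * X)) :
    (Xᵀ * X).PosDef := by
  have h : (Xᵀ * X).PosSemidef := by
    simpa using Matrix.posSemidef_conjTranspose_mul_self X
  exact h.posDef_iff_isUnit.2 hX

/-- The normal equations. -/
theorem transpose_mulVec_residual {X : Matrix (Fin n) (Fin p) ℝ} (hX : IsUnit (Xᵀ * X))
    (y : Fin n → ℝ) : Xᵀ *ᵥ (y - X *ᵥ (lsEstimator X y).ofLp) = 0 := by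
  rw [Matrix.mulVec_sub, Matrix.mulVec_mulVec, lsEstimator, Matrix.mulVec_mulVec,
    Matrix.mul_nonsing_inv _ ((Matrix.isUnit_iff_isUnit_det _).1 hX), Matrix.one_mulVec, sub_self]

theorem objective_eq_lassoObjective {X : Matrix (Fin n) (Fin p) ℝ} (hX : IsUnit (Xᵀ * X))
    (lam : Fin p → ℝ) (y : Fin n → ℝ) (b : EuclideanSpace ℝ (Fin p)) :
    objective X lam y b
      = lassoObjective (Xᵀ * X) (lsEstimator X y) (fun j => lam j / |lsEstimator X y j|) 0 b
        + ∑ i, (y i - (X *ᵥ (lsEstimator X y).ofLp) i) ^ 2 := by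
  set s := lsEstimator X y with hs
  set r : Fin n → ℝ := y - X *ᵥ s.ofLp with hr
  have hcross : r ⬝ᵥ (X *ᵥ (b - s).ofLp) = 0 := by
    rw [Matrix.dotProduct_mulVec, ← Matrix.mulVec_transpose, transpose_mulVec_residual hX,
      zero_dotProduct]
  have hquad : (b - s).ofLp ⬝ᵥ (Xᵀ * X) *ᵥ (b - s).ofLp
      = (X *ᵥ (b - s).ofLp) ⬝ᵥ (X *ᵥ (b - s).ofLp) := by
    rw [← Matrix.mulVec_mulVec, Matrix.dotProduct_mulVec, ← Matrix.mulVec_transpose,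
      Matrix.transpose_transpose]
  have hres : ∀ i, y i - (X *ᵥ b.ofLp) i = r i - (X *ᵥ (b - s).ofLp) i := by
    intro i
    simp [hr, Matrix.mulVec_sub]
  rw [objective, lassoObjective, hquad]
  have h1 : ∑ i, (y i - (X *ᵥ b.ofLp) i) ^ 2
      = (X *ᵥ (b - s).ofLp) ⬝ᵥ (X *ᵥ (b - s).ofLp) + ∑ i, r i ^ 2 := by
    have h2 : ∑ i, (y i - (X *ᵥ b.ofLp) i) ^ 2
        = (X *ᵥ (b - s).ofLp) ⬝ᵥ (X *ᵥ (b - s).ofLp) + ∑ i, r i ^ 2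
          - 2 * (r ⬝ᵥ (X *ᵥ (b - s).ofLp)) := by
      simp only [dotProduct, Finset.mul_sum, ← Finset.sum_add_distrib, ← Finset.sum_sub_distrib]
      refine Finset.sum_congr rfl fun i _ => ?_
      rw [hres]; ring
    rw [h2, hcross]; ring
  rw [h1]
  simp only [Pi.zero_apply, add_zero, abs_zero, sub_zero, hr, Pi.sub_apply]
  have h3 : ∀ j, lam j * (|b j| / |s j|) = lam j / |s j| * |b j| := fun j => by ring
  simp only [← hs, h3]
  ring

theorem isMinOn_objective_iff {X : Matrix (Fin n) (Fin p) ℝ} (hX : IsUnit (Xᵀ * X))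
    (lam : Fin p → ℝ) (y : Fin n → ℝ) (b : EuclideanSpace ℝ (Fin p)) :
    IsMinOn (objective X lam y) Set.univ b ↔ IsMinOn (lassoObjective (Xᵀ * X) (lsEstimator X y)
      (fun j => lam j / |lsEstimator X y j|) 0) Set.univ b := by
  simp only [isMinOn_iff, objective_eq_lassoObjective hX, add_le_add_iff_right]

theorem existsUnique_isMinOn_objective {X : Matrix (Fin n) (Fin p) ℝ} (hX : IsUnit (Xᵀ * X))
    {lam : Fin p → ℝ} (hlam : ∀ j, 0 ≤ lam j) (y : Fin n → ℝ) :
    ∃! b, IsMinOn (objective X lam y) Set.univ b := by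
  simp only [isMinOn_objective_iff hX]
  exact existsUnique_isMinOn_lassoObjective (posDef_of_isUnit hX) _
    (fun j => div_nonneg (hlam j) (abs_nonneg _)) _

/-- If `X'X` is singular, its inverse is `0` in Mathlib, hence so is `lsEstimator`, and the penalty
vanishes because of division by zero. The objective is then constant along the kernel of `X`, so
that its minimizer is not unique and `argmin` takes its default value. -/
theorem estimator_eq_zero {X : Matrix (Fin n) (Fin p) ℝ} (hX : ¬ IsUnit (Xᵀ * X))
    (lam : Fin p → ℝ) (y : Fin n → ℝ) : estimator X lam y = 0 := by
  refine dif_neg ?_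
  rintro ⟨m, hm, huniq⟩
  have hdet : (Xᵀ * X).det = 0 := by
    by_contra h
    exact hX ((Matrix.isUnit_iff_isUnit_det _).2 (isUnit_iff_ne_zero.2 h))
  obtain ⟨v, hv0, hv⟩ := Matrix.exists_mulVec_eq_zero_iff.2 hdet
  have hXv : X *ᵥ v = 0 := by
    have := (Matrix.conjTranspose_mul_self_mulVec_eq_zero X v).1 (by simpa using hv)
    exact this
  have hls : lsEstimator X y = 0 := by
    rw [lsEstimator, Matrix.nonsing_inv_apply_not_isUnit _ (by simp [hdet])]
    simp
  have hobj : objective X lam y (m + WithLp.toLp 2 v) = objective X lam y m := by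
    simp [objective, hls, Matrix.mulVec_add, hXv]
  have hm' : IsMinOn (objective X lam y) Set.univ (m + WithLp.toLp 2 v) := by
    rw [isMinOn_iff] at hm ⊢
    simpa only [hobj] using hm
  have := huniq _ hm'
  rw [add_eq_left] at this
  exact hv0 (by simpa using congrArg WithLp.ofLp this)

theorem continuous_lsEstimator (X : Matrix (Fin n) (Fin p) ℝ) : Continuous (lsEstimator X) :=
  (PiLp.continuous_toLp 2 _).comp
    (Continuous.matrix_mulVec continuous_const
      (Continuous.matrix_mulVec continuous_const continuous_id))

theorem continuous_argmin_lassoObjective {ι : Type*} [Fintype ι] {A : Matrix ι ι ℝ}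
    (hA : A.PosDef) (d : ι → ℝ) :
    Continuous fun q : EuclideanSpace ℝ ι × (ι → ℝ) =>
      argmin (lassoObjective A q.1 (fun j => |q.2 j|) d) := by
  refine continuous_iff_continuousAt.2 fun q => ?_
  have hex := fun q : EuclideanSpace ℝ ι × (ι → ℝ) =>
    existsUnique_isMinOn_lassoObjective hA q.1 (fun j => abs_nonneg (q.2 j)) d
  refine tendsto_of_isMinOn_lassoObjective (T := ∅) (A := fun _ => A) (c := Prod.fst)
    (w := fun q j => |q.2 j|) (d := fun _ => d) (d0 := d) (w0 := fun j => |q.2 j|) (c0 := q.1)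
    hA tendsto_const_nhds continuous_fst.continuousAt (fun q j => abs_nonneg _)
    (fun j => abs_nonneg _) (by simp) (by simp) (by simp) (fun j _ => ?_)
    (fun j _ => Or.inr tendsto_const_nhds) (Eventually.of_forall fun q => isMinOn_argmin (hex q))
    (by simp) (by simpa using isMinOn_argmin (hex q))
  exact (show Continuous fun q : EuclideanSpace ℝ ι × (ι → ℝ) => |q.2 j| by fun_prop).continuousAt

/-- The estimator is a continuous function of the least-squares estimator and the penalty weights
`lam j / |lsEstimator j|`; the latter are measurable but not continuous in the data. -/
theorem measurable_estimator (X : Matrix (Fin n) (Fin p) ℝ) {lam : Fin p → ℝ}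
    (hlam : ∀ j, 0 ≤ lam j) : Measurable (estimator X lam) := by
  by_cases hX : IsUnit (Xᵀ * X)
  · have hls : Measurable (lsEstimator X) := (continuous_lsEstimator X).measurable
    have hlsj : ∀ j, Measurable fun y => lsEstimator X y j := fun j =>
      (show Measurable fun b : EuclideanSpace ℝ (Fin p) => b j by fun_prop).comp hls
    have hq : Measurable fun y => (lsEstimator X y, fun j => lam j / |lsEstimator X y j|) :=
      hls.prodMk (measurable_pi_lambda _ fun j => measurable_const.div (hlsj j).abs)
    have hA := posDef_of_isUnit hX
    have heq : estimator X lam = (fun q : EuclideanSpace ℝ (Fin p) × (Fin p → ℝ) =>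
        argmin (lassoObjective (Xᵀ * X) q.1 (fun j => |q.2 j|) 0)) ∘
        fun y => (lsEstimator X y, fun j => lam j / |lsEstimator X y j|) := by
      funext y
      have hw : ∀ j, 0 ≤ lam j / |lsEstimator X y j| := fun j =>
        div_nonneg (hlam j) (abs_nonneg _)
      have hex := existsUnique_isMinOn_lassoObjective hA (lsEstimator X y) hw 0
      simp only [Function.comp_apply, abs_of_nonneg (hw _)]
      exact hex.unique ((isMinOn_objective_iff hX lam y _).1
        (isMinOn_argmin (existsUnique_isMinOn_objective hX hlam y))) (isMinOn_argmin hex)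
    rw [heq]
    exact (continuous_argmin_lassoObjective hA 0).measurable.comp hq
  · convert (measurable_const : Measurable fun _ : Fin n → ℝ => (0 : EuclideanSpace ℝ (Fin p)))
      using 2 with y
    exact estimator_eq_zero hX lam y

/-- Effect of the substitution `b = β + r u` and of division by `s`. -/
theorem lassoObjective_add_smul {ι : Type*} [Fintype ι] (A : Matrix ι ι ℝ)
    (c β : EuclideanSpace ℝ ι) (w : ι → ℝ) {r s : ℝ} (hr : 0 < r) (hs : 0 < s)
    (u : EuclideanSpace ℝ ι) :
    lassoObjective A c w 0 (β + r • u)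
      = s * lassoObjective ((r ^ 2 / s) • A) (r⁻¹ • (c - β)) (fun j => r / s * w j)
          (fun j => r⁻¹ * β j) u + 2 * ∑ j, w j * |β j| := by
  have h1 : (β + r • u - c).ofLp = r • (u - r⁻¹ • (c - β)).ofLp := by
    ext j
    simp
    field_simp
    ring
  have h2 : ∀ j, w j * (|(β + r • u) j + (0 : ι → ℝ) j| - |(0 : ι → ℝ) j|)
      = s * (r / s * w j * (|u j + r⁻¹ * β j| - |r⁻¹ * β j|)) + w j * |β j| := by
    intro j
    have h3 : |(β + r • u) j| = r * |u j + r⁻¹ * β j| := by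
      rw [← abs_of_pos hr, ← abs_mul, abs_of_pos hr]
      congr 1
      simp
      field_simp
      ring
    have h4 : |r⁻¹ * β j| = r⁻¹ * |β j| := by rw [abs_mul, abs_of_pos (inv_pos.2 hr)]
    rw [Pi.zero_apply, add_zero, abs_zero, sub_zero, h3, h4]
    field_simp
    ring
  simp only [lassoObjective, h1, h2]
  rw [Finset.sum_add_distrib, ← Finset.mul_sum]
  simp only [Matrix.mulVec_smul, Matrix.smul_mulVec, dotProduct_smul, smul_dotProduct, smul_eq_mul]
  field_simp
  ring

theorem isMinOn_lassoObjective_rescale {ι : Type*} [Fintype ι] {A : Matrix ι ι ℝ}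
    {c β : EuclideanSpace ℝ ι} {w : ι → ℝ} {r s : ℝ} (hr : 0 < r) (hs : 0 < s)
    {b : EuclideanSpace ℝ ι} (hb : IsMinOn (lassoObjective A c w 0) Set.univ b) :
    IsMinOn (lassoObjective ((r ^ 2 / s) • A) (r⁻¹ • (c - β)) (fun j => r / s * w j)
      (fun j => r⁻¹ * β j)) Set.univ (r⁻¹ • (b - β)) := by
  rw [isMinOn_iff] at hb ⊢
  intro u _
  have hbu := hb (β + r • u) (Set.mem_univ _)
  have hb' : b = β + r • (r⁻¹ • (b - β)) := by
    rw [smul_smul, mul_inv_cancel₀ hr.ne', one_smul, add_sub_cancel]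
  rw [hb', lassoObjective_add_smul A c β w hr hs, lassoObjective_add_smul A c β w hr hs] at hbu
  exact le_of_mul_le_mul_left (by linarith) hs

/-! ### The limiting objective -/

theorem coe_finsetSum {ι : Type*} (s : Finset ι) (f : ι → ℝ) :
    ((∑ i ∈ s, f i : ℝ) : EReal) = ∑ i ∈ s, (f i : EReal) := by
  classical
  induction s using Finset.induction_on with
  | empty => simp
  | insert i s hi ih => rw [Finset.sum_insert hi, Finset.sum_insert hi, EReal.coe_add, ih]

theorem finsetSum_eq_top {ι : Type*} {s : Finset ι} {f : ι → EReal} (hbot : ∀ i, f i ≠ ⊥)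
    {i : ι} (hi : i ∈ s) (htop : f i = ⊤) : ∑ i ∈ s, f i = ⊤ := by
  classical
  have h : ∀ t : Finset ι, ∑ i ∈ t, f i ≠ ⊥ := by
    intro t
    induction t using Finset.induction_on with
    | empty => simp
    | insert i t hi ih =>
      rw [Finset.sum_insert hi]
      exact fun h => (EReal.add_eq_bot_iff.1 h).elim (hbot i) ih
  rw [← Finset.add_sum_erase s f hi, htop, EReal.top_add_of_ne_bot (h _)]

/-- The coordinates `j` with `phi j = psi j = 0`, where the limiting objective is infinite unless
`u j = 0`. -/
def constrained (psi : Fin p → ℝ≥0∞) (phi : Fin p → EReal) : Set (Fin p) :=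
  {j | phi j = 0 ∧ psi j = 0}

open Classical in
/-- The weights of the limiting penalty. They vanish for coordinates without penalty and, by
convention, for the constrained ones. -/
noncomputable def limitWeight (psi : Fin p → ℝ≥0∞) (phi : Fin p → EReal)
    (z : EuclideanSpace ℝ (Fin p)) (j : Fin p) : ℝ :=
  if phi j = ⊤ ∨ phi j = ⊥ ∨ psi j = ∞ ∨ (phi j = 0 ∧ psi j = 0) then 0
  else 1 / |(phi j).toReal + (psi j).toReal * z j|

theorem limitWeight_nonneg (psi : Fin p → ℝ≥0∞) (phi : Fin p → EReal)
    (z : EuclideanSpace ℝ (Fin p)) (j : Fin p) : 0 ≤ limitWeight psi phi z j := by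
  unfold limitWeight
  split_ifs <;> positivity

theorem limitPenalty_ne_bot (lam0 : ℝ) (psi : ℝ≥0∞) (phi : EReal) (z u : ℝ) :
    limitPenalty lam0 psi phi z u ≠ ⊥ := by
  unfold limitPenalty
  split_ifs
  exacts [by simp, by simp, EReal.coe_ne_bot _]

theorem limitObjective_eq_top (C : Matrix (Fin p) (Fin p) ℝ) (lam0 : Fin p → ℝ)
    {psi : Fin p → ℝ≥0∞} {phi : Fin p → EReal} (z : EuclideanSpace ℝ (Fin p))
    {u : EuclideanSpace ℝ (Fin p)} (hu : ¬ ∀ j ∈ constrained psi phi, u j = 0) :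
    limitObjective C lam0 psi phi z u = ⊤ := by
  push Not at hu
  obtain ⟨j, ⟨hj1, hj2⟩, hj⟩ := hu
  rw [limitObjective, finsetSum_eq_top (fun i => limitPenalty_ne_bot _ _ _ _ _)
    (Finset.mem_univ j), EReal.coe_add_top]
  simp [limitPenalty, hj1, hj2, hj]

theorem limitObjective_eq_coe (C : Matrix (Fin p) (Fin p) ℝ) (lam0 : Fin p → ℝ)
    {psi : Fin p → ℝ≥0∞} {phi : Fin p → EReal} (z : EuclideanSpace ℝ (Fin p))
    {u : EuclideanSpace ℝ (Fin p)} (hu : ∀ j ∈ constrained psi phi, u j = 0) :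
    limitObjective C lam0 psi phi z u = (lassoObjective C 0 (limitWeight psi phi z)
      (fun j => lam0 j * (phi j).toReal) u : ℝ) := by
  have h : ∀ j, limitPenalty (lam0 j) (psi j) (phi j) (z j) (u j)
      = ((2 * (limitWeight psi phi z j * (|u j + lam0 j * (phi j).toReal|
        - |lam0 j * (phi j).toReal|)) : ℝ) : EReal) := by
    intro j
    by_cases hT : phi j = 0 ∧ psi j = 0
    · simp [limitPenalty, hT, hu j hT, limitWeight]
    · by_cases h1 : phi j = ⊤ ∨ phi j = ⊥ ∨ psi j = ∞
      · rw [limitPenalty, if_pos (Or.inr h1), limitWeight, if_pos (by tauto)]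
        simp
      · by_cases h2 : u j = 0
        · simp [limitPenalty, h2]
        · rw [limitPenalty, if_neg (by tauto), if_neg hT, limitWeight, if_neg (by tauto)]
          congr 1
          ring
  rw [limitObjective, lassoObjective, EReal.coe_add, Finset.mul_sum, coe_finsetSum]
  simp only [h, sub_zero]

/-- Minimizing the extended-real limiting objective is a constrained real minimization. -/
theorem isMinOn_limitObjective_iff (C : Matrix (Fin p) (Fin p) ℝ) (lam0 : Fin p → ℝ)
    (psi : Fin p → ℝ≥0∞) (phi : Fin p → EReal) (z m : EuclideanSpace ℝ (Fin p)) :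
    IsMinOn (limitObjective C lam0 psi phi z) Set.univ m ↔
      (∀ j ∈ constrained psi phi, m j = 0) ∧ IsMinOn (lassoObjective C 0 (limitWeight psi phi z)
        (fun j => lam0 j * (phi j).toReal)) {u | ∀ j ∈ constrained psi phi, u j = 0} m := by
  constructor
  · intro hm
    have hmT : ∀ j ∈ constrained psi phi, m j = 0 := by
      by_contra hcon
      have h0 : limitObjective C lam0 psi phi z m ≤ _ := hm (Set.mem_univ 0)
      rw [limitObjective_eq_top C lam0 z hcon, limitObjective_eq_coe C lam0 z (by simp)] at h0
      exact EReal.coe_ne_top _ (top_le_iff.1 h0)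
    refine ⟨hmT, fun u hu => ?_⟩
    have h0 : limitObjective C lam0 psi phi z m ≤ _ := hm (Set.mem_univ u)
    rw [limitObjective_eq_coe C lam0 z hmT, limitObjective_eq_coe C lam0 z hu] at h0
    exact EReal.coe_le_coe_iff.1 h0
  · rintro ⟨hmT, hm⟩ u -
    change limitObjective C lam0 psi phi z m ≤ limitObjective C lam0 psi phi z u
    by_cases hu : ∀ j ∈ constrained psi phi, u j = 0
    · rw [limitObjective_eq_coe C lam0 z hmT, limitObjective_eq_coe C lam0 z hu]
      exact EReal.coe_le_coe_iff.2 (hm hu)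
    · rw [limitObjective_eq_top C lam0 z hu]
      exact le_top

theorem existsUnique_isMinOn_limitObjective {C : Matrix (Fin p) (Fin p) ℝ} (hC : C.PosDef)
    (lam0 : Fin p → ℝ) (psi : Fin p → ℝ≥0∞) (phi : Fin p → EReal)
    (z : EuclideanSpace ℝ (Fin p)) :
    ∃! m, IsMinOn (limitObjective C lam0 psi phi z) Set.univ m := by
  simp only [isMinOn_limitObjective_iff]
  obtain ⟨m, hmT, hm⟩ := exists_isMinOn_lassoObjective hC 0 (limitWeight_nonneg psi phi z)
    (fun j => lam0 j * (phi j).toReal) (constrained psi phi)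
  exact ⟨m, ⟨hmT, hm⟩, fun m' hm' =>
    eq_of_isMinOn_lassoObjective hC (limitWeight_nonneg psi phi z) hm'.1 hmT hm'.2 hm⟩

end

/-! ### Convergence of the rescaled minimizers -/

section

variable {κ : Type*} {l : Filter κ} {p : ℕ}

theorem tendsto_div_sqrt_of_ratio_top {M L : κ → ℝ} (hM : Tendsto M l atTop) (hL : ∀ k, 0 ≤ L k)
    (h : Tendsto (fun k => ENNReal.ofReal (√(M k)) / ENNReal.ofReal (L k)) l (𝓝 ∞)) :
    Tendsto (fun k => L k / √(M k)) l (𝓝 0) := by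
  have h1 : Tendsto (fun k => (ENNReal.ofReal (√(M k)) / ENNReal.ofReal (L k))⁻¹.toReal) l
      (𝓝 0) := by
    have h2 := (ENNReal.tendsto_toReal (a := (∞ : ℝ≥0∞)⁻¹) (by simp)).comp
      ((continuous_inv.tendsto _).comp h)
    rw [ENNReal.inv_top, ENNReal.toReal_zero] at h2
    exact h2
  refine h1.congr' ?_
  filter_upwards [hM.eventually_gt_atTop 0] with k hk
  rw [ENNReal.inv_div (Or.inl ENNReal.ofReal_ne_top) (Or.inr (by simpa using hk)),
    ENNReal.toReal_div, ENNReal.toReal_ofReal (hL k), ENNReal.toReal_ofReal (Real.sqrt_nonneg _)]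

theorem tendsto_sqrt_div_of_ratio {M L : κ → ℝ} (hM : Tendsto M l atTop)
    (hL : ∀ k, 0 ≤ L k) {psi : ℝ≥0∞} (hpsi : psi ≠ ∞)
    (h : Tendsto (fun k => ENNReal.ofReal (√(M k)) / ENNReal.ofReal (L k)) l (𝓝 psi)) :
    (∀ᶠ k in l, 0 < L k) ∧ Tendsto (fun k => √(M k) / L k) l (𝓝 psi.toReal) := by
  constructor
  · filter_upwards [h.eventually_lt_const (lt_top_iff_ne_top.2 hpsi),
      hM.eventually_gt_atTop 0] with k hk hMk
    refine (hL k).lt_of_ne fun h0 => hk.ne ?_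
    rw [← h0, ENNReal.ofReal_zero, ENNReal.div_zero]
    simpa using hMk
  · refine ((ENNReal.tendsto_toReal hpsi).comp h).congr fun k => ?_
    simp [ENNReal.toReal_div, ENNReal.toReal_ofReal (hL k)]

theorem tendsto_inv_abs_add_of_infinite {x ζ : κ → ℝ} {b : EReal} {z : ℝ} (hb : b = ⊤ ∨ b = ⊥)
    (hx : Tendsto (fun k => (x k : EReal)) l (𝓝 b)) (hζ : Tendsto ζ l (𝓝 z)) :
    Tendsto (fun k => |x k + ζ k|⁻¹) l (𝓝 0) := by
  refine tendsto_inv_atTop_zero.comp ?_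
  rcases hb with rfl | rfl
  · exact tendsto_abs_atTop_atTop.comp
      ((EReal.tendsto_coe_nhds_top_iff.1 hx).atTop_add hζ)
  · exact tendsto_abs_atBot_atTop.comp
      ((EReal.tendsto_coe_nhds_bot_iff.1 hx).atBot_add hζ)

/-- If `x` tends to `b` in the extended reals and `ζ` to a point other than `-b`, then `1 / |x + ζ|`
converges; for infinite `b` the junk value of `b.toReal` only strengthens the assumption. -/
theorem exists_tendsto_inv_abs_add {x ζ : κ → ℝ} {b : EReal} {z : ℝ}
    (hx : Tendsto (fun k => (x k : EReal)) l (𝓝 b)) (hζ : Tendsto ζ l (𝓝 z))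
    (hbz : z ≠ -b.toReal) : ∃ c, Tendsto (fun k => |x k + ζ k|⁻¹) l (𝓝 c) := by
  by_cases hb : b = ⊤ ∨ b = ⊥
  · exact ⟨0, tendsto_inv_abs_add_of_infinite hb hx hζ⟩
  · push Not at hb
    lift b to ℝ using hb
    have hx' : Tendsto x l (𝓝 b) := EReal.tendsto_coe.1 hx
    refine ⟨_, ((hx'.add hζ).abs).inv₀ ?_⟩
    rw [abs_ne_zero]
    intro h
    exact hbz (by rw [EReal.toReal_coe]; linarith)

theorem isMinOn_argmin_limitObjective {C : Matrix (Fin p) (Fin p) ℝ} (hC : C.PosDef)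
    (lam0 : Fin p → ℝ) (psi : Fin p → ℝ≥0∞) (phi : Fin p → EReal)
    (z : EuclideanSpace ℝ (Fin p)) :
    (∀ j ∈ constrained psi phi, argmin (limitObjective C lam0 psi phi z) j = 0) ∧
      IsMinOn (lassoObjective C 0 (limitWeight psi phi z) (fun j => lam0 j * (phi j).toReal))
        {u | ∀ j ∈ constrained psi phi, u j = 0} (argmin (limitObjective C lam0 psi phi z)) :=
  (isMinOn_limitObjective_iff C lam0 psi phi z _).1
    (isMinOn_argmin (existsUnique_isMinOn_limitObjective hC lam0 psi phi z))

theorem limitWeight_eq_zero_of_mem {psi : Fin p → ℝ≥0∞} {phi : Fin p → EReal}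
    (z : EuclideanSpace ℝ (Fin p)) {j : Fin p} (hj : j ∈ constrained psi phi) :
    limitWeight psi phi z j = 0 :=
  if_pos (Or.inr (Or.inr (Or.inr hj)))

/-- The constrained minimizer is the limit of unconstrained ones with weights `k → ∞` on the
constrained coordinates. -/
theorem measurable_argmin_limitObjective {C : Matrix (Fin p) (Fin p) ℝ} (hC : C.PosDef)
    (lam0 : Fin p → ℝ) (psi : Fin p → ℝ≥0∞) (phi : Fin p → EReal) :
    Measurable fun z => argmin (limitObjective C lam0 psi phi z) := by
  classical
  set w : ℕ → EuclideanSpace ℝ (Fin p) → Fin p → ℝ := fun k z j =>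
    if j ∈ constrained psi phi then (k : ℝ) else limitWeight psi phi z j with hwdef
  have hw : ∀ k z j, 0 ≤ w k z j := fun k z j => by
    simp only [hwdef]
    split_ifs
    exacts [Nat.cast_nonneg k, limitWeight_nonneg psi phi z j]
  have hwm : ∀ k, Measurable (w k) := fun k => by
    refine measurable_pi_lambda _ fun j => ?_
    simp only [hwdef, limitWeight]
    split_ifs
    · exact measurable_const
    · exact measurable_const
    · exact measurable_const.div (Measurable.abs (by fun_prop))
  set d : Fin p → ℝ := fun j => lam0 j * (phi j).toReal with hd
  refine measurable_of_tendsto_metrizable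
    (f := fun (k : ℕ) z => argmin (lassoObjective C 0 (fun j => |w k z j|) d)) (fun k => ?_) ?_
  · have hq : Measurable fun z : EuclideanSpace ℝ (Fin p) =>
        ((0 : EuclideanSpace ℝ (Fin p)), w k z) := measurable_const.prodMk (hwm k)
    have heq : (fun z => argmin (lassoObjective C 0 (fun j => |w k z j|) d)) =
        (fun q : EuclideanSpace ℝ (Fin p) × (Fin p → ℝ) =>
          argmin (lassoObjective C q.1 (fun j => |q.2 j|) d)) ∘ fun z => (0, w k z) := rfl
    rw [heq]
    exact (continuous_argmin_lassoObjective hC d).measurable.comp hq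
  · rw [tendsto_pi_nhds]
    intro z
    obtain ⟨h0T, h0⟩ := isMinOn_argmin_limitObjective hC lam0 psi phi z
    refine tendsto_of_isMinOn_lassoObjective (T := constrained psi phi) (A := fun _ => C)
      (c := fun _ => 0) (w := fun k j => |w k z j|) (d := fun _ => d) hC tendsto_const_nhds
      tendsto_const_nhds (fun _ _ => abs_nonneg _) (limitWeight_nonneg psi phi z)
      (fun j hj => limitWeight_eq_zero_of_mem z hj) (fun j hj => ?_) (fun j hj => ?_)
      (fun j hj => ?_) (fun j hj => Or.inr tendsto_const_nhds)
      (Eventually.of_forall fun k => isMinOn_argmin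
        (existsUnique_isMinOn_lassoObjective hC _ (fun j => abs_nonneg _) _)) h0T h0
    · simpa [hwdef, hj] using tendsto_natCast_atTop_atTop
    · simp [hd, hj.1]
    · simp [hwdef, hj, abs_of_nonneg (limitWeight_nonneg psi phi z j)]

/-- The points `z` near which all weights behave: `z j` is not the negative of the limit `b j` of
`√n β j`, and `phi j + psi j * z j ≠ 0` wherever this is the denominator of the limiting penalty. For
infinite `b j` the first condition excludes the irrelevant point `0`. -/
def Regular (psi : Fin p → ℝ≥0∞) (phi b : Fin p → EReal) (z : EuclideanSpace ℝ (Fin p)) : Prop :=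
  ∀ j, z j ≠ -(b j).toReal ∧ (psi j ≠ ∞ → phi j ≠ ⊤ → phi j ≠ ⊥ → ¬(phi j = 0 ∧ psi j = 0) →
    (phi j).toReal + (psi j).toReal * z j ≠ 0)

/-- Convergence of the rescaled minimizers for a deterministic convergent least-squares error `ζ`.
The assumption `hne` says that no coordinate of the least-squares estimator vanishes; otherwise
division by zero would remove the penalty on coordinates where it has to become infinite. -/
theorem tendsto_minimizer_limitObjective {A : κ → Matrix (Fin p) (Fin p) ℝ}
    {C : Matrix (Fin p) (Fin p) ℝ} (hC : C.PosDef) (hA : Tendsto A l (𝓝 C))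
    {M N : κ → ℝ} (hM : Tendsto M l atTop) (hN : ∀ k, 0 ≤ N k)
    {lam : κ → Fin p → ℝ} (hlam : ∀ k j, 0 ≤ lam k j)
    {β : κ → EuclideanSpace ℝ (Fin p)}
    {lam0 : Fin p → ℝ} {psi : Fin p → ℝ≥0∞} {phi b : Fin p → EReal}
    (hlam0 : ∀ j, Tendsto (fun k => lam k j / M k) l (𝓝 (lam0 j)))
    (hpsi : ∀ j, Tendsto (fun k => ENNReal.ofReal (√(M k)) / ENNReal.ofReal (lam k j)) l
      (𝓝 (psi j)))
    (hphi : ∀ j, psi j ≠ ∞ → Tendsto (fun k => ((√(N k) * β k j * √(M k) / lam k j : ℝ) : EReal)) l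
      (𝓝 (phi j)))
    (hb : ∀ j, Tendsto (fun k => ((√(N k) * β k j : ℝ) : EReal)) l (𝓝 (b j)))
    {ζ : κ → EuclideanSpace ℝ (Fin p)} {z : EuclideanSpace ℝ (Fin p)} (hζ : Tendsto ζ l (𝓝 z))
    (hz : Regular psi phi b z) (hne : ∀ᶠ k in l, ∀ j, √(N k) * β k j + ζ k j ≠ 0)
    {m : κ → EuclideanSpace ℝ (Fin p)}
    (hm : ∀ᶠ k in l, IsMinOn (lassoObjective (A k) ((√(M k))⁻¹ • ζ k)
      (fun j => lam k j / √(M k) * |√(N k) * β k j + ζ k j|⁻¹)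
      (fun j => √(N k / M k) * β k j)) Set.univ (m k)) :
    Tendsto m l (𝓝 (argmin (limitObjective C lam0 psi phi z))) := by
  obtain ⟨h0T, h0⟩ := isMinOn_argmin_limitObjective hC lam0 psi phi z
  have hζj : ∀ j, Tendsto (fun k => ζ k j) l (𝓝 (z j)) := fun j =>
    ((PiLp.continuous_apply 2 _ j).tendsto z).comp hζ
  have hsqrt : Tendsto (fun k => √(M k)) l atTop := Real.tendsto_sqrt_atTop.comp hM
  -- For finite `psi j` the weight is `1 / |φ + ψ ζ|`, with `φ` and `ψ` the sequences tending to
  -- `phi j` and `psi j`.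
  have hweight : ∀ j, psi j ≠ ∞ → ∀ᶠ k in l,
      |√(N k) * β k j * √(M k) / lam k j + √(M k) / lam k j * ζ k j|⁻¹
        = lam k j / √(M k) * |√(N k) * β k j + ζ k j|⁻¹ := by
    intro j hj
    filter_upwards [(tendsto_sqrt_div_of_ratio hM (fun k => hlam k j) hj (hpsi j)).1,
      hsqrt.eventually_gt_atTop 0] with k hk hMk
    have : √(N k) * β k j * √(M k) / lam k j + √(M k) / lam k j * ζ k j
        = √(M k) / lam k j * (√(N k) * β k j + ζ k j) := by ring
    rw [this, abs_mul, mul_inv, abs_of_pos (div_pos hMk hk), inv_div]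
  have hψζ : ∀ j, psi j ≠ ∞ → Tendsto (fun k => √(M k) / lam k j * ζ k j) l
      (𝓝 ((psi j).toReal * z j)) := fun j hj =>
    (tendsto_sqrt_div_of_ratio hM (fun k => hlam k j) hj (hpsi j)).2.mul (hζj j)
  -- The shift is the product of the sequences tending to `lam0 j` and `phi j`.
  have hshift : ∀ j, psi j ≠ ∞ → phi j ≠ ⊤ → phi j ≠ ⊥ →
      Tendsto (fun k => √(N k / M k) * β k j) l (𝓝 (lam0 j * (phi j).toReal)) := by
    intro j hj h1 h2
    have hφ : Tendsto (fun k => √(N k) * β k j * √(M k) / lam k j) l (𝓝 (phi j).toReal) :=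
      EReal.tendsto_coe.1 (by rw [EReal.coe_toReal h1 h2]; exact hphi j hj)
    refine ((hlam0 j).mul hφ).congr' ?_
    filter_upwards [(tendsto_sqrt_div_of_ratio hM (fun k => hlam k j) hj (hpsi j)).1,
      hM.eventually_gt_atTop 0] with k hk hMk
    rw [Real.sqrt_div (hN k)]
    have hs : √(M k) ≠ 0 := (Real.sqrt_pos.2 hMk).ne'
    field_simp
    rw [Real.sq_sqrt hMk.le]
    ring
  refine tendsto_of_isMinOn_lassoObjective (T := constrained psi phi) hC hA ?_ (fun k j => ?_)
    (limitWeight_nonneg psi phi z) (fun j hj => limitWeight_eq_zero_of_mem z hj)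
    (fun j hj => ?_) (fun j hj => ?_) (fun j hj => ?_) (fun j hj => ?_) hm h0T h0
  · simpa using (tendsto_inv_atTop_zero.comp hsqrt).smul hζ
  · exact mul_nonneg (div_nonneg (hlam k j) (Real.sqrt_nonneg _)) (inv_nonneg.2 (abs_nonneg _))
  · obtain ⟨hj1, hj2⟩ := hj
    have hj2' : psi j ≠ ∞ := by simp [hj2]
    refine Tendsto.congr' (hweight j hj2') ?_
    have hφ : Tendsto (fun k => √(N k) * β k j * √(M k) / lam k j) l (𝓝 0) :=
      EReal.tendsto_coe.1 (by rw [EReal.coe_zero, ← hj1]; exact hphi j hj2')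
    refine Tendsto.inv_tendsto_nhdsGT_zero (tendsto_nhdsWithin_iff.2 ⟨?_, ?_⟩)
    · simpa [hj2] using (hφ.add (hψζ j hj2')).abs
    · filter_upwards [(tendsto_sqrt_div_of_ratio hM (fun k => hlam k j) hj2' (hpsi j)).1,
        hsqrt.eventually_gt_atTop 0, hne] with k hk hMk hnek
      have : √(N k) * β k j * √(M k) / lam k j + √(M k) / lam k j * ζ k j
          = √(M k) / lam k j * (√(N k) * β k j + ζ k j) := by ring
      rw [this, Set.mem_Ioi, abs_pos]
      exact mul_ne_zero (div_pos hMk hk).ne' (hnek j)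
  · obtain ⟨hj1, hj2⟩ := hj
    simpa [hj1] using hshift j (by simp [hj2]) (by simp [hj1]) (by simp [hj1])
  · by_cases hψ : psi j = ∞
    · obtain ⟨c, hc⟩ := exists_tendsto_inv_abs_add (hb j) (hζj j) (hz j).1
      have := (tendsto_div_sqrt_of_ratio_top hM (fun k => hlam k j) (hψ ▸ hpsi j)).mul hc
      simpa [limitWeight, hψ] using this
    · refine Tendsto.congr' (hweight j hψ) ?_
      by_cases hinf : phi j = ⊤ ∨ phi j = ⊥
      · rw [limitWeight, if_pos (by tauto)]
        exact tendsto_inv_abs_add_of_infinite hinf (hphi j hψ) (hψζ j hψ)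
      · have hT : ¬(phi j = 0 ∧ psi j = 0) := hj
        rw [limitWeight, if_neg (by tauto), one_div]
        push Not at hinf
        have hφ : Tendsto (fun k => √(N k) * β k j * √(M k) / lam k j) l (𝓝 (phi j).toReal) :=
          EReal.tendsto_coe.1 (by rw [EReal.coe_toReal hinf.1 hinf.2]; exact hphi j hψ)
        exact ((hφ.add (hψζ j hψ)).abs).inv₀
          (abs_ne_zero.2 ((hz j).2 hψ hinf.1 hinf.2 hT))
  · by_cases hcase : psi j = ∞ ∨ phi j = ⊤ ∨ phi j = ⊥
    · exact Or.inl (if_pos (by tauto))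
    · push Not at hcase
      exact Or.inr (hshift j hcase.1 hcase.2.1 hcase.2.2)

theorem ae_regular {Ω' : Type*} [MeasurableSpace Ω'] {P' : Measure Ω'}
    {S : Matrix (Fin p) (Fin p) ℝ} (hS : S.PosDef)
    {Z : Ω' → EuclideanSpace ℝ (Fin p)} (hZ : HasLaw Z (multivariateGaussian 0 S) P')
    (psi : Fin p → ℝ≥0∞) (phi b : Fin p → EReal) :
    ∀ᵐ ω ∂P', Regular psi phi b (Z ω) := by
  have hpoint : ∀ j (x : ℝ), ∀ᵐ ω ∂P', Z ω j ≠ x := by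
    intro j x
    have hlaw : HasLaw (fun ω => Z ω j) (gaussianReal ((0 : EuclideanSpace ℝ (Fin p)) j)
        (S j j).toNNReal) P' :=
      (measurePreserving_eval_multivariateGaussian (μ := 0) hS.posSemidef).fun_comp_hasLaw hZ
    have hv : (S j j).toNNReal ≠ 0 := by
      simpa using hS.diag_pos
    have := nullSingletonClass_gaussianReal (μ := (0 : EuclideanSpace ℝ (Fin p)) j) hv
    rw [hlaw.ae_iff (p := fun y => y ≠ x) (by fun_prop)]
    exact Measure.ae_ne _ x
  unfold Regular
  rw [ae_all_iff]
  intro j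
  filter_upwards [hpoint j (-(b j).toReal), hpoint j (-(phi j).toReal / (psi j).toReal)]
    with ω h1 h2
  refine ⟨h1, fun hψ htop hbot hT h => ?_⟩
  by_cases h0 : (psi j).toReal = 0
  · have hψ0 : psi j = 0 := ((ENNReal.toReal_eq_zero_iff _).1 h0).resolve_right hψ
    rw [h0, zero_mul, add_zero, EReal.toReal_eq_zero_iff] at h
    tauto
  · refine h2 ?_
    rw [eq_div_iff h0]
    linarith

end

/-! ### Asymptotic distribution of the estimators -/

section

variable {p : ℕ}

/-- The vector `√n (X'X)⁻¹ xᵢ`, with `xᵢ` the `i`-th row of `X`: the weight of the `i`-th error in the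
normalised least-squares error. -/
noncomputable def lsWeight {n : ℕ} (X : Matrix (Fin n) (Fin p) ℝ) (i : Fin n) :
    EuclideanSpace ℝ (Fin p) :=
  WithLp.toLp 2 (√n • ((Xᵀ * X)⁻¹ *ᵥ X i))

theorem lsEstimator_response {n : ℕ} {X : Matrix (Fin n) (Fin p) ℝ} (hX : IsUnit (Xᵀ * X))
    (β : EuclideanSpace ℝ (Fin p)) (e : Fin n → ℝ) :
    √n • (lsEstimator X (response X β e) - β) = ∑ i, e i • lsWeight X i := by
  have h : lsEstimator X (response X β e) - β = WithLp.toLp 2 ((Xᵀ * X)⁻¹ *ᵥ (Xᵀ *ᵥ e)) := by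
    rw [lsEstimator, response, Matrix.mulVec_add, Matrix.mulVec_add, Matrix.mulVec_mulVec,
      Matrix.mulVec_mulVec, Matrix.mul_assoc,
      Matrix.nonsing_inv_mul _ ((Matrix.isUnit_iff_isUnit_det _).1 hX),
      Matrix.one_mulVec]
    ext j
    simp
  rw [h, Matrix.mulVec_eq_sum (M := Xᵀ)]
  ext j
  simp [lsWeight, Matrix.mulVec_sum, Matrix.mulVec_smul, Finset.mul_sum, Matrix.transpose_transpose]
  refine Finset.sum_congr rfl fun i _ => ?_
  ring

theorem tendsto_inv_gram {X : (n : ℕ) → Matrix (Fin n) (Fin p) ℝ} {C : Matrix (Fin p) (Fin p) ℝ}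
    (hC : C.PosDef) (hXC : Tendsto (fun n : ℕ => (n : ℝ)⁻¹ • ((X n)ᵀ * X n)) atTop (𝓝 C)) :
    Tendsto (fun n : ℕ => ((n : ℝ)⁻¹ • ((X n)ᵀ * X n))⁻¹) atTop (𝓝 C⁻¹) := by
  refine (continuousAt_matrix_inv C ?_).tendsto.comp hXC
  rw [Ring.inverse_eq_inv']
  exact continuousAt_inv₀ hC.det_pos.ne'

theorem eventually_isUnit_gram {X : (n : ℕ) → Matrix (Fin n) (Fin p) ℝ}
    {C : Matrix (Fin p) (Fin p) ℝ}
    (hC : C.PosDef) (hXC : Tendsto (fun n : ℕ => (n : ℝ)⁻¹ • ((X n)ᵀ * X n)) atTop (𝓝 C)) :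
    ∀ᶠ n in atTop, IsUnit ((X n)ᵀ * X n) := by
  have hdet : Tendsto (fun n : ℕ => ((n : ℝ)⁻¹ • ((X n)ᵀ * X n)).det) atTop (𝓝 C.det) :=
    ((continuous_id.matrix_det).tendsto C).comp hXC
  filter_upwards [hdet.eventually_ne hC.det_pos.ne'] with n hn
  rw [Matrix.isUnit_iff_isUnit_det, isUnit_iff_ne_zero]
  intro h0
  rw [Matrix.det_smul, h0, mul_zero] at hn
  exact hn rfl

theorem sum_inner_lsWeight_sq {n : ℕ} (hn : 0 < n) {X : Matrix (Fin n) (Fin p) ℝ}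
    (hX : IsUnit (Xᵀ * X)) (t : EuclideanSpace ℝ (Fin p)) :
    ∑ i, inner ℝ (lsWeight X i) t ^ 2 = t.ofLp ⬝ᵥ ((n : ℝ)⁻¹ • (Xᵀ * X))⁻¹ *ᵥ t.ofLp := by
  have hdet := (Matrix.isUnit_iff_isUnit_det _).1 hX
  have hsymm : ((Xᵀ * X)⁻¹)ᵀ = (Xᵀ * X)⁻¹ := by
    rw [Matrix.transpose_nonsing_inv, Matrix.transpose_mul, Matrix.transpose_transpose]
  set B := (Xᵀ * X)⁻¹ with hB
  have h1 : ∀ i, inner ℝ (lsWeight X i) t = √n * (X *ᵥ (B *ᵥ t.ofLp)) i := by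
    intro i
    have h2 : inner ℝ (lsWeight X i) t = √n * ((B *ᵥ X i) ⬝ᵥ t.ofLp) := by
      simp [lsWeight, EuclideanSpace.inner_eq_star_dotProduct, dotProduct_comm, hB]
    rw [h2, dotProduct_comm, Matrix.dotProduct_mulVec, ← Matrix.mulVec_transpose, hsymm,
      dotProduct_comm]
    rfl
  have hn' : (0 : ℝ) < n := by exact_mod_cast hn
  have hinv : ((n : ℝ)⁻¹ • (Xᵀ * X))⁻¹ = (n : ℝ) • B := by
    refine Matrix.inv_eq_left_inv ?_
    rw [Matrix.smul_mul, Matrix.mul_smul, smul_smul, mul_inv_cancel₀ hn'.ne', one_smul, hB,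
      Matrix.nonsing_inv_mul _ hdet]
  simp only [h1, mul_pow, Real.sq_sqrt hn'.le]
  rw [← Finset.mul_sum, hinv, Matrix.smul_mulVec, dotProduct_smul, smul_eq_mul]
  congr 1
  have h3 : ∑ i, (X *ᵥ (B *ᵥ t.ofLp)) i ^ 2 = (X *ᵥ (B *ᵥ t.ofLp)) ⬝ᵥ (X *ᵥ (B *ᵥ t.ofLp)) := by
    simp only [dotProduct, sq]
  rw [h3, Matrix.dotProduct_mulVec, ← Matrix.mulVec_transpose, Matrix.mulVec_mulVec,
    Matrix.mulVec_mulVec, hB, Matrix.mul_nonsing_inv _ hdet, Matrix.one_mulVec]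

/-- With `A = X'X / n` the weight `v` satisfies `A v = xᵢ / √n`, so a lower bound on the quadratic form
of `A` bounds the norm of `v` by a multiple of the norm of `xᵢ / √n`. -/
theorem eventually_norm_lsWeight_le {X : (n : ℕ) → Matrix (Fin n) (Fin p) ℝ}
    {C : Matrix (Fin p) (Fin p) ℝ} (hC : C.PosDef)
    (hXC : Tendsto (fun n : ℕ => (n : ℝ)⁻¹ • ((X n)ᵀ * X n)) atTop (𝓝 C))
    (hX : ∀ δ : ℝ, 0 < δ → ∀ᶠ n : ℕ in atTop, ∀ i : Fin n, ∑ j, X n i j ^ 2 ≤ δ * n)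
    {δ : ℝ} (hδ : 0 < δ) : ∀ᶠ n in atTop, ∀ i, ‖lsWeight (X n) i‖ ≤ δ := by
  obtain ⟨a, ha, hquad⟩ := eventually_le_quadratic hC hXC
  filter_upwards [hquad, eventually_isUnit_gram hC hXC, hX ((a * δ) ^ 2) (by positivity),
    eventually_gt_atTop 0] with n h1 h2 h3 hn i
  have hn' : (0 : ℝ) < n := by exact_mod_cast hn
  have hdet := (Matrix.isUnit_iff_isUnit_det _).1 h2
  set v := lsWeight (X n) i with hv
  set x : EuclideanSpace ℝ (Fin p) := WithLp.toLp 2 (X n i) with hx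
  have hAv : ((n : ℝ)⁻¹ • ((X n)ᵀ * X n)) *ᵥ v.ofLp = (√n)⁻¹ • x.ofLp := by
    rw [hv, lsWeight, hx, Matrix.mulVec_smul, Matrix.smul_mulVec, Matrix.mulVec_mulVec,
      Matrix.mul_nonsing_inv _ hdet, Matrix.one_mulVec, smul_smul]
    congr 1
    have := Real.sq_sqrt hn'.le
    have hs := (Real.sqrt_pos.2 hn').ne'
    field_simp
    linarith
  have hxn : ‖x‖ ≤ a * δ * √n := by
    rw [EuclideanSpace.norm_eq, ← Real.sqrt_sq (by positivity : 0 ≤ a * δ), ← Real.sqrt_mul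
      (sq_nonneg _)]
    refine Real.sqrt_le_sqrt ?_
    simpa [hx] using h3 i
  have hinner : v.ofLp ⬝ᵥ x.ofLp ≤ ‖v‖ * ‖x‖ := by
    have := real_inner_le_norm v x
    rwa [EuclideanSpace.inner_eq_star_dotProduct, star_trivial, dotProduct_comm] at this
  have h4 := h1 v
  rw [hAv, dotProduct_smul, smul_eq_mul] at h4
  have h5 : a * ‖v‖ ^ 2 ≤ a * δ * ‖v‖ := by
    have hs := Real.sqrt_pos.2 hn'
    calc a * ‖v‖ ^ 2 ≤ (√n)⁻¹ * (‖v‖ * (a * δ * √n)) := by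
          refine h4.trans ?_
          gcongr
          exact hinner.trans (by gcongr)
      _ = a * δ * ‖v‖ := by field_simp
  by_contra! hcon
  have hvpos : 0 < ‖v‖ := hδ.trans hcon
  nlinarith [mul_lt_mul_of_pos_left hcon (mul_pos ha hvpos)]

/-- Asymptotic normality of the least-squares estimator. -/
theorem tendstoInDistribution_lsEstimator {Ω : Type*} [MeasurableSpace Ω] {P : Measure Ω}
    [IsProbabilityMeasure P] {Ω' : Type*} [MeasurableSpace Ω'] {P' : Measure Ω'}
    [IsProbabilityMeasure P']
    {X : (n : ℕ) → Matrix (Fin n) (Fin p) ℝ} {C : Matrix (Fin p) (Fin p) ℝ}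
    (hC : C.PosDef)
    (hXC : Tendsto (fun n : ℕ => (n : ℝ)⁻¹ • ((X n)ᵀ * X n)) atTop (𝓝 C))
    (hX : ∀ δ : ℝ, 0 < δ → ∀ᶠ n : ℕ in atTop, ∀ i : Fin n, ∑ j, X n i j ^ 2 ≤ δ * n)
    {ν : Measure ℝ} {σ : ℝ} (hν2 : MemLp id 2 ν)
    (hν_mean : ∫ x, x ∂ν = 0) (hν_var : ∫ x, x ^ 2 ∂ν = σ ^ 2)
    {ε : (n : ℕ) → Fin n → Ω → ℝ}
    (hε_law : ∀ n i, HasLaw (ε n i) ν P) (hε_indep : ∀ n, iIndepFun (ε n) P)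
    (β : ℕ → EuclideanSpace ℝ (Fin p))
    {Z : Ω' → EuclideanSpace ℝ (Fin p)}
    (hZ : HasLaw Z (multivariateGaussian 0 (σ ^ 2 • C⁻¹)) P') :
    TendstoInDistribution (fun (n : ℕ) ω => √n • (lsEstimator (X n)
      (response (X n) (β n) (fun i => ε n i ω)) - β n)) atTop Z (fun _ => P) P' := by
  refine (tendstoInDistribution_sum_smul hν2 hν_mean hν_var hε_law hε_indep
    hC.inv.posSemidef (v := fun n => lsWeight (X n))
    (fun δ hδ => eventually_norm_lsWeight_le hC hXC hX hδ) (fun t => ?_) hZ).congr_eventually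
    (fun n => ?_) ?_
  · refine (tendsto_quadratic (tendsto_inv_gram hC hXC) (tendsto_const_nhds (x := t))).congr' ?_
    filter_upwards [eventually_isUnit_gram hC hXC, eventually_gt_atTop 0] with n h1 h2
    exact (sum_inner_lsWeight_sq h2 h1 t).symm
  · have hε : AEMeasurable (fun ω i => ε n i ω) P :=
      aemeasurable_pi_lambda _ fun i => (hε_law n i).aemeasurable
    have hc : Continuous fun e : Fin n → ℝ =>
        √n • (lsEstimator (X n) (response (X n) (β n) e) - β n) :=
      (((continuous_lsEstimator (X n)).comp (continuous_const.add continuous_id)).sub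
        continuous_const).fun_const_smul _
    exact hc.measurable.comp_aemeasurable hε
  · filter_upwards [eventually_isUnit_gram hC hXC] with n hn
    exact Eventually.of_forall fun ω => (lsEstimator_response hn (β n) _).symm

/-- The rescaled estimation error minimizes a `lassoObjective` whose parameters depend on the data only
through the normalised least-squares error. -/
theorem isMinOn_lassoObjective_estimator {n : ℕ} (hn : 0 < n) {X : Matrix (Fin n) (Fin p) ℝ}
    (hX : IsUnit (Xᵀ * X)) {lam : Fin p → ℝ} (hlam : ∀ j, 0 ≤ lam j) {M : ℝ} (hM : 0 < M)
    (β : EuclideanSpace ℝ (Fin p)) (y : Fin n → ℝ) :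
    IsMinOn (lassoObjective ((n : ℝ)⁻¹ • (Xᵀ * X)) ((√M)⁻¹ • (√n • (lsEstimator X y - β)))
      (fun j => lam j / √M * |√n * β j + (√n • (lsEstimator X y - β)) j|⁻¹)
      (fun j => √(n / M) * β j)) Set.univ (√(n / M) • (estimator X lam y - β)) := by
  have hn' : (0 : ℝ) < n := by exact_mod_cast hn
  have hr : 0 < √(M / n) := Real.sqrt_pos.2 (by positivity)
  have h := isMinOn_lassoObjective_rescale (β := β) hr hM
    ((isMinOn_objective_iff hX lam y _).1
      (isMinOn_argmin (existsUnique_isMinOn_objective hX hlam y)))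
  have hsM : 0 < √M := Real.sqrt_pos.2 hM
  have hsn : 0 < √(n : ℝ) := Real.sqrt_pos.2 hn'
  have hMM := Real.mul_self_sqrt hM.le
  have hrinv : (√(M / n))⁻¹ = √(n / M) := by rw [← Real.sqrt_inv, inv_div]
  have hrdiv : √(n / M) = (√M)⁻¹ * √n := by
    rw [Real.sqrt_div hn'.le]; ring
  have e1 : √(M / n) ^ 2 / M = (n : ℝ)⁻¹ := by
    rw [Real.sq_sqrt (by positivity)]; field_simp
  have e2 : ∀ j, √(M / n) / M * (lam j / |lsEstimator X y j|)
      = lam j / √M * |√n * β j + (√n • (lsEstimator X y - β)) j|⁻¹ := by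
    intro j
    have h1 : √n * β j + (√n • (lsEstimator X y - β)) j = √n * lsEstimator X y j := by
      simp; ring
    rw [h1, abs_mul, mul_inv, abs_of_pos hsn, Real.sqrt_div hM.le, div_eq_mul_inv (lam j)]
    have h2 : √M / √n / M = (√M)⁻¹ * (√n)⁻¹ := by
      field_simp; nlinarith
    rw [h2]; ring
  rw [e1, hrinv] at h
  simp only [e2] at h
  rw [smul_smul, ← hrdiv]
  exact h

theorem aemeasurable_rescaled_estimator {Ω : Type*} [MeasurableSpace Ω] {P : Measure Ω} {n : ℕ}
    (X : Matrix (Fin n) (Fin p) ℝ) {lam : Fin p → ℝ} (hlam : ∀ j, 0 ≤ lam j)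
    {y : Ω → Fin n → ℝ} (hy : AEMeasurable y P) (r : ℝ) (β : EuclideanSpace ℝ (Fin p)) :
    AEMeasurable (fun ω => r • (estimator X lam (y ω) - β)) P := by
  have h : AEMeasurable (fun ω => estimator X lam (y ω)) P :=
    (measurable_estimator X hlam).comp_aemeasurable hy
  fun_prop

/-- The adaptive Lasso limit, deduced from the asymptotic normality of the least-squares estimator. -/
theorem tendstoInDistribution_estimator {Ω : Type*} [MeasurableSpace Ω] {P : Measure Ω}
    [IsProbabilityMeasure P] {Ω' : Type*} [MeasurableSpace Ω'] {P' : Measure Ω'}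
    [IsProbabilityMeasure P']
    {X : (n : ℕ) → Matrix (Fin n) (Fin p) ℝ} {C : Matrix (Fin p) (Fin p) ℝ}
    (hC : C.PosDef)
    (hXC : Tendsto (fun n : ℕ => (n : ℝ)⁻¹ • ((X n)ᵀ * X n)) atTop (𝓝 C))
    {y : (n : ℕ) → Ω → Fin n → ℝ} (hy : ∀ n, AEMeasurable (y n) P)
    {β : ℕ → EuclideanSpace ℝ (Fin p)}
    {lam : ℕ → Fin p → ℝ} (hlam : ∀ n j, 0 ≤ lam n j)
    (hLS : ∀ᶠ n : ℕ in atTop, ∀ j, ∀ᵐ ω ∂P, lsEstimator (X n) (y n ω) j ≠ 0)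
    {M : ℕ → ℝ} (hM : Tendsto M atTop atTop)
    {lam0 : Fin p → ℝ} {psi : Fin p → ℝ≥0∞} {phi : Fin p → EReal}
    (hlam0 : ∀ j, Tendsto (fun n : ℕ => lam n j / M n) atTop (𝓝 (lam0 j)))
    (hpsi : ∀ j, Tendsto (fun n : ℕ => ENNReal.ofReal (√(M n)) / ENNReal.ofReal (lam n j)) atTop
      (𝓝 (psi j)))
    (hphi : ∀ j, psi j ≠ ∞ → Tendsto (fun n : ℕ => ((√n * β n j * √(M n) / lam n j : ℝ) : EReal))
      atTop (𝓝 (phi j)))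
    {Z : Ω' → EuclideanSpace ℝ (Fin p)} {S : Matrix (Fin p) (Fin p) ℝ} (hS : S.PosDef)
    (hZ : HasLaw Z (multivariateGaussian 0 S) P')
    (hlim : TendstoInDistribution (fun (n : ℕ) ω => √n • (lsEstimator (X n) (y n ω) - β n))
      atTop Z (fun _ => P) P') :
    TendstoInDistribution (fun (n : ℕ) ω => √(n / M n) • (estimator (X n) (lam n) (y n ω) - β n))
      atTop (fun ω => argmin (limitObjective C lam0 psi phi (Z ω))) (fun _ => P) P' where
  forall_aemeasurable n := aemeasurable_rescaled_estimator _ (hlam n) (hy n) _ _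
  aemeasurable_limit :=
    (measurable_argmin_limitObjective hC lam0 psi phi).comp_aemeasurable hZ.aemeasurable
  tendsto := by
    -- Extract a subsequence along which `√n β j` converges in the extended reals for every `j`.
    refine tendsto_of_subseq_tendsto fun ns hns => ?_
    obtain ⟨b, ms, hms, hb⟩ := CompactSpace.tendsto_subseq
      (fun k : ℕ => fun j : Fin p => ((√(ns k : ℝ) * β (ns k) j : ℝ) : EReal))
    refine ⟨ms, ?_⟩
    set N : ℕ → ℕ := fun k => ns (ms k) with hNdef
    have hN : Tendsto N atTop atTop := hns.comp hms.tendsto_atTop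
    have hbj : ∀ j, Tendsto (fun k => ((√(N k : ℝ) * β (N k) j : ℝ) : EReal)) atTop (𝓝 (b j)) :=
      fun j => (tendsto_pi_nhds.1 hb) j
    have hlimN : TendstoInDistribution (fun (k : ℕ) ω =>
        √(N k : ℝ) • (lsEstimator (X (N k)) (y (N k) ω) - β (N k))) atTop Z (fun _ => P) P' :=
      ⟨fun k => hlim.forall_aemeasurable (N k), hlim.aemeasurable_limit, hlim.tendsto.comp hN⟩
    have hYm : ∀ k, AEMeasurable (fun ω => √(N k / M (N k)) •
        (estimator (X (N k)) (lam (N k)) (y (N k) ω) - β (N k))) P := fun k =>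
      aemeasurable_rescaled_estimator _ (hlam (N k)) (hy (N k)) _ _
    set f : ℕ → EuclideanSpace ℝ (Fin p) → EuclideanSpace ℝ (Fin p) → ℝ := fun k x =>
      lassoObjective ((N k : ℝ)⁻¹ • ((X (N k))ᵀ * X (N k))) ((√(M (N k)))⁻¹ • x)
        (fun j => lam (N k) j / √(M (N k)) * |√(N k) * β (N k) j + x j|⁻¹)
        (fun j => √(N k / M (N k)) * β (N k) j) with hf
    have hgood : ∀ᶠ k in atTop, 0 < N k ∧ IsUnit ((X (N k))ᵀ * X (N k)) ∧ 0 < M (N k) :=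
      (hN.eventually_gt_atTop 0).and ((hN.eventually (eventually_isUnit_gram hC hXC)).and
        ((hM.comp hN).eventually_gt_atTop 0))
    have hex : ∀ k, 0 < N k ∧ IsUnit ((X (N k))ᵀ * X (N k)) ∧ 0 < M (N k) →
        ∀ x, ∃! m, IsMinOn (f k x) Set.univ m := fun k ⟨h1, h2, _⟩ x => by
      refine existsUnique_isMinOn_lassoObjective ((posDef_of_isUnit h2).smul ?_) _ (fun j => ?_) _
      · have : (0 : ℝ) < N k := by exact_mod_cast h1
        positivity
      · exact mul_nonneg (div_nonneg (hlam _ j) (Real.sqrt_nonneg _)) (inv_nonneg.2 (abs_nonneg _))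
    have key := tendstoInDistribution_of_tendsto_prod hlimN
      (Y := fun k ω => √(N k / M (N k)) •
        (estimator (X (N k)) (lam (N k)) (y (N k) ω) - β (N k)))
      (g := fun k x => argmin (f k x))
      (G := fun z => argmin (limitObjective C lam0 psi phi z))
      (S := fun k => {x | ∀ j, √(N k : ℝ) * β (N k) j + x j ≠ 0}) hYm
      ((measurable_argmin_limitObjective hC lam0 psi phi).comp_aemeasurable hZ.aemeasurable)
      ?_ ?_
    · exact key.tendsto
    · filter_upwards [hgood, hN.eventually hLS] with k hk hLSk
      filter_upwards [ae_all_iff.2 hLSk] with ω hω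
      constructor
      · intro j
        have h1 : √(N k : ℝ) * β (N k) j
            + (√(N k : ℝ) • (lsEstimator (X (N k)) (y (N k) ω) - β (N k))) j
            = √(N k : ℝ) * lsEstimator (X (N k)) (y (N k) ω) j := by
          simp; ring
        rw [h1]
        have : (0 : ℝ) < N k := by exact_mod_cast hk.1
        exact mul_ne_zero (Real.sqrt_pos.2 this).ne' (hω j)
      · exact (hex k hk _).unique
          (isMinOn_lassoObjective_estimator hk.1 hk.2.1 (hlam _) hk.2.2 (β (N k)) (y (N k) ω))
          (isMinOn_argmin (hex k hk _))
    · filter_upwards [ae_regular hS hZ psi phi b] with ω hω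
      have hfst : Tendsto (fun q : ℕ × EuclideanSpace ℝ (Fin p) => q.1)
          ((atTop ×ˢ 𝓝 (Z ω)) ⊓ 𝓟 {q | ∀ j, √(N q.1 : ℝ) * β (N q.1) j + q.2 j ≠ 0}) atTop :=
        tendsto_fst.mono_left inf_le_left
      have hNf := hN.comp hfst
      refine tendsto_minimizer_limitObjective
        (κ := ℕ × EuclideanSpace ℝ (Fin p)) (N := fun q => (N q.1 : ℝ)) (M := fun q => M (N q.1))
        (lam := fun q => lam (N q.1)) (β := fun q => β (N q.1)) (ζ := fun q => q.2)
        (A := fun q => (N q.1 : ℝ)⁻¹ • ((X (N q.1))ᵀ * X (N q.1))) hC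
        (hXC.comp hNf) (hM.comp hNf) (fun q => Nat.cast_nonneg _) (fun q => hlam _)
        (fun j => (hlam0 j).comp hNf) (fun j => (hpsi j).comp hNf)
        (fun j hj => (hphi j hj).comp hNf) (fun j => (hbj j).comp hfst)
        (tendsto_snd.mono_left inf_le_left) hω ?_ ?_
      · exact mem_inf_of_right (mem_principal_self _)
      · filter_upwards [hfst.eventually hgood] with q hq
        exact isMinOn_argmin (hex q.1 hq q.2)

end

end AdaptiveLasso

theorem theorem3 {p : ℕ}
    -- the probability space carrying the errors
    {Ω : Type*} [MeasurableSpace Ω] (P : Measure Ω) [IsProbabilityMeasure P]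
    -- the probability space carrying the limit
    {Ω' : Type*} [MeasurableSpace Ω'] (P' : Measure Ω') [IsProbabilityMeasure P']
    -- designs
    (X : (n : ℕ) → Matrix (Fin n) (Fin p) ℝ) (C : Matrix (Fin p) (Fin p) ℝ)
    (hC : C.PosDef)
    (hXC : Tendsto (fun n : ℕ => (n : ℝ)⁻¹ • ((X n)ᵀ * X n)) atTop (𝓝 C))
    (hX : ∀ δ : ℝ, 0 < δ → ∀ᶠ n : ℕ in atTop, ∀ i : Fin n, ∑ j, X n i j ^ 2 ≤ δ * n)
    -- errors
    (ν : Measure ℝ) (σ : ℝ) (hσ : 0 < σ) (hν2 : MemLp id 2 ν)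
    (hν_mean : ∫ x, x ∂ν = 0) (hν_var : ∫ x, x ^ 2 ∂ν = σ ^ 2)
    (ε : (n : ℕ) → Fin n → Ω → ℝ)
    (hε_law : ∀ n i, HasLaw (ε n i) ν P) (hε_indep : ∀ n, iIndepFun (ε n) P)
    -- true parameters and tuning parameters
    (β : ℕ → EuclideanSpace ℝ (Fin p))
    (lam : ℕ → Fin p → ℝ) (hlam : ∀ n j, 0 ≤ lam n j)
    (hLS : ∀ᶠ n : ℕ in atTop, ∀ j, ∀ᵐ ω ∂P, AdaptiveLasso.lsEstimator (X n)
      (AdaptiveLasso.response (X n) (β n) (fun i => ε n i ω)) j ≠ 0)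
    (hlam_n : Tendsto (fun n : ℕ => AdaptiveLasso.lamMax (lam n) / n) atTop (𝓝 0))
    (hlam_top : Tendsto (fun n : ℕ => AdaptiveLasso.lamMax (lam n)) atTop atTop)
    -- limits of the tuning and true parameters
    (lam0 : Fin p → ℝ) (psi : Fin p → ℝ≥0∞) (phi : Fin p → EReal)
    (hlam0 : ∀ j, Tendsto (fun n : ℕ => lam n j / AdaptiveLasso.lamMax (lam n)) atTop
      (𝓝 (lam0 j)))
    (hpsi : ∀ j, Tendsto (fun n : ℕ => ENNReal.ofReal (Real.sqrt (AdaptiveLasso.lamMax (lam n)))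
      / ENNReal.ofReal (lam n j)) atTop (𝓝 (psi j)))
    (hphi : ∀ j, psi j ≠ ∞ → Tendsto (fun n : ℕ => ((Real.sqrt n * β n j
      * Real.sqrt (AdaptiveLasso.lamMax (lam n)) / lam n j : ℝ) : EReal)) atTop (𝓝 (phi j)))
    -- the Gaussian vector
    (Z : Ω' → EuclideanSpace ℝ (Fin p))
    (hZ : HasLaw Z (multivariateGaussian 0 (σ ^ 2 • C⁻¹)) P') :
    (∀ᶠ n : ℕ in atTop, ∀ᵐ ω ∂P, ∃! b, IsMinOn (AdaptiveLasso.objective (X n) (lam n)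
      (AdaptiveLasso.response (X n) (β n) (fun i => ε n i ω))) Set.univ b) ∧
    (∀ᵐ ω ∂P', ∃! m, IsMinOn (AdaptiveLasso.limitObjective C lam0 psi phi (Z ω)) Set.univ m) ∧
    TendstoInDistribution
      (fun (n : ℕ) (ω : Ω) => Real.sqrt (n / AdaptiveLasso.lamMax (lam n)) •
        (AdaptiveLasso.estimator (X n) (lam n)
          (AdaptiveLasso.response (X n) (β n) (fun i => ε n i ω)) - β n))
      atTop
      (fun ω => AdaptiveLasso.argmin (AdaptiveLasso.limitObjective C lam0 psi phi (Z ω)))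
      (fun _ => P) P' := by
  refine ⟨?_, Eventually.of_forall fun ω =>
    AdaptiveLasso.existsUnique_isMinOn_limitObjective hC lam0 psi phi (Z ω), ?_⟩
  · filter_upwards [AdaptiveLasso.eventually_isUnit_gram hC hXC] with n hn
    exact Eventually.of_forall fun ω =>
      AdaptiveLasso.existsUnique_isMinOn_objective hn (hlam n) _
  · refine AdaptiveLasso.tendstoInDistribution_estimator hC hXC (fun n => ?_) hlam hLS hlam_top
      hlam0 hpsi hphi (hC.inv.smul (by positivity)) hZ
      (AdaptiveLasso.tendstoInDistribution_lsEstimator hC hXC hX hν2 hν_mean hν_var hε_law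
        hε_indep β hZ)
    exact aemeasurable_const.add
      (aemeasurable_pi_lambda _ fun i => (hε_law n i).aemeasurable)
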